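/- Let $\mathcal H$ be the class of closed convex polygons $H\subset\mathbb R^2$ with nonempty interior which tessellate the plane by translations, i.e. for some $T\subset\mathbb R^2$ the translates $t+H$, $t\in T$, cover $\mathbb R^2$ and have pairwise disjoint interiors. For a line $\pi$ through the origin with unit normal $v$, write $L_x=\{x+tv: t\in\mathbb R\}$ for $x\in\pi$, and let $$S_\pi(E)=\bigcup_{x\in\pi,\ L_x\cap E\neq\emptyset}\{x+rv:\ 2|r|\le \mathcal H^1(E\cap L_x)\}$$ be the Steiner symmetrization of $E$ with respect to $\pi$, where $\mathcal H^1$ is the one-dimensional Hausdorff measure. Let $\mathcal F:\mathcal H\to\mathbb R\cup\{+\infty\}$ satisfy: (a) if $H_n,H\in\mathcal H$ and $H_n\to H$ in the Hausdorff distance, then $\mathcal F(H)\le\liminf_n\mathcal F(H_n)$; (b) $\mathcal F(S_\pi(H))\le\mathcal F(H)$ for every line $\pi$ through the origin and every $H\in\mathcal H$ such that $S_\pi(H)\in\mathcal H$. Then $\mathcal F$ attains its minimum over $\{H\in\mathcal H: |H|=1\}$ at a regular hexagon $H^*$ of unit area: $$\min_{H\in\mathcal H,\ |H|=1}\mathcal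 F(H)=\mathcal F(H^*).$$ If moreover $\mathcal F$ takes equal values on congruent elements of $\mathcal H$, then every regular hexagon of unit area belongs to $\mathcal H$ and is such a minimizer. Finally, if the inequality in (b) is strict whenever $S_\pi(H)\in\mathcal H$ is not a translate of $H$, then the regular hexagon is the unique minimizer up to congruence: every $H\in\mathcal H$ with $|H|=1$ that minimizes $\mathcal F$ among the elements of $\mathcal H$ of unit area is a regular hexagon. -/

import Mathlib

/-- The Euclidean plane. -/
abbrev Plane := EuclideanSpace ℝ (Fin 2)

/-- A (nondegenerate, closed) convex polygon: the convex hull of finitely many points,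
with nonempty interior. -/
def IsConvexPolygon (H : Set Plane) : Prop :=
  (∃ s : Finset Plane, H = convexHull ℝ (s : Set Plane)) ∧ (interior H).Nonempty

/-- `H` tessellates the plane by translations: for some set `T` of translation vectors the
translates `t + H`, `t ∈ T`, cover the plane and have pairwise disjoint interiors. -/
def TessellatesByTranslations (H : Set Plane) : Prop :=
  ∃ T : Set Plane,
    (⋃ t ∈ T, (fun x => t + x) '' H) = Set.univ ∧
    T.PairwiseDisjoint fun t => interior ((fun x => t + x) '' H)

/-- The class of convex polygons which tessellate the plane by translations. -/
def TranslationTiles : Set (Set Plane) :=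
  {H | IsConvexPolygon H ∧ TessellatesByTranslations H}

/-- The line through `x` with direction `v`. -/
def normalLine (v x : Plane) : Set Plane := {y | ∃ t : ℝ, y = x + t • v}

/-- The Steiner symmetrization of `E` with respect to the line through the origin
`π = {x | ⟪x, v⟫ = 0}` with unit normal `v`: each chord `E ∩ (x + ℝ v)`, `x ∈ π`, that is not
empty is replaced by the segment of the same length (one-dimensional Hausdorff measure) on the
same line which is centred at `x`. -/
def steinerSymm (v : Plane) (E : Set Plane) : Set Plane :=
  {y | ∃ (x : Plane) (r : ℝ), inner ℝ x v = 0 ∧ (normalLine v x ∩ E).Nonempty ∧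
    ENNReal.ofReal (2 * |r|) ≤ MeasureTheory.Measure.hausdorffMeasure 1 (E ∩ normalLine v x) ∧
    y = x + r • v}

/-- `K` is a translate of `H`. -/
def IsTranslateOf (K H : Set Plane) : Prop := ∃ t : Plane, K = (fun x => t + x) '' H

/-- `K` is congruent to `H`: the image of `H` under an isometry of the plane. -/
def IsCongruentTo (K H : Set Plane) : Prop := ∃ f : Plane ≃ᵢ Plane, K = f '' H

/-- A closed regular hexagon, with arbitrary centre `c`, circumradius `r > 0` and orientation
`θ`. -/
def IsRegularHexagon (H : Set Plane) : Prop :=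
  ∃ (c : Plane) (r θ : ℝ), 0 < r ∧
    H = convexHull ℝ (Set.range fun k : Fin 6 =>
      c + !₂[r * Real.cos (θ + (k : ℕ) * (Real.pi / 3)),
             r * Real.sin (θ + (k : ℕ) * (Real.pi / 3))])

/-- Sequential lower semicontinuity with respect to convergence in the Hausdorff distance, inside
the class of translation tiles. -/
def HausdorffLSC (F : TranslationTiles → EReal) : Prop :=
  ∀ (Hs : ℕ → TranslationTiles) (H : TranslationTiles),
    Filter.Tendsto (fun n => Metric.hausdorffDist (Hs n : Set Plane) (H : Set Plane))
      Filter.atTop (nhds 0) →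
    F H ≤ Filter.liminf (fun n => F (Hs n)) Filter.atTop

/-- `F` does not increase under Steiner symmetrization, whenever the symmetrized polygon
belongs to the domain of `F` as well. -/
def SteinerNonincreasing (F : TranslationTiles → EReal) : Prop :=
  ∀ (v : Plane), ‖v‖ = 1 → ∀ H K : TranslationTiles,
    (K : Set Plane) = steinerSymm v H → F K ≤ F H

/-- `F` strictly decreases under every Steiner symmetrization which changes the polygon (not
merely its position by a translation), whenever the symmetrized polygon belongs to the domain
of `F` as well. -/
def SteinerStrict (F : TranslationTiles → EReal) : Prop :=
  ∀ (v : Plane), ‖v‖ = 1 → ∀ H K : TranslationTiles,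
    (K : Set Plane) = steinerSymm v H → ¬ IsTranslateOf (K : Set Plane) H → F K < F H

/-- `F` takes equal values on congruent tiles. -/
def CongruenceInvariant (F : TranslationTiles → EReal) : Prop :=
  ∀ H K : TranslationTiles, IsCongruentTo (K : Set Plane) H → F K = F H

/-- `H` has unit area and minimizes `F` among the translation tiles of unit area. -/
def IsUnitAreaMinimizer (F : TranslationTiles → EReal) (H : TranslationTiles) : Prop :=
  MeasureTheory.volume (H : Set Plane) = 1 ∧
    ∀ K : TranslationTiles, MeasureTheory.volume (K : Set Plane) = 1 → F H ≤ F K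

/-! A convex polygon that tiles by translations is a parallelogram or a centrally symmetric hexagon,
that is, a zonogon with edge vectors `e₁`, `e₂`, `e₃` in counterclockwise order, possibly parallel
or zero (`exists_zonogon_of_tile`). Conversely, every such zonogon of positive area tiles along the
lattice generated by `e₁ + e₂` and `e₂ + e₃` (`zonogon_tessellates`), and its area is the
determinant of that lattice (`volume_zonogon`).

The chords parallel to the short diagonal `e₁ + e₂` sweep a central parallelogram and two triangles.
Symmetrization in this direction centres each chord without changing its length, so it produces
another zonogon of the same area (`steinerSymm_zonogon`), hence an admissible tile. The energy,
which is the sum of the squared lengths of the centre and of the edge vectors, drops by the squares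
of the components that the symmetrization removes (`energy_symm`).

No infinite sequence of symmetrizations is needed. Among the unit-area zonogons with `F` at most a
given value, compactness and semicontinuity provide one of least energy. Symmetrizing it can gain
nothing along `e₁ + e₂` or `e₂ + e₃`, and the resulting orthogonality relations force a regular
hexagon centred at the origin (`exists_regular_le`). Such hexagons have bounded energy, so
minimizing `F` over unit-area data of bounded energy gives a global minimizer, which can again be
replaced by a regular hexagon.

Under strictness, a minimizer is a translate of its symmetrizations. Comparing widths gives the same
orthogonality relations (`symmetric_of_translate`), except when two edge vectors are parallel. In
that case the tile is a parallelogram, and reading it as a zonogon with another choice of generators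
gives a contradiction (`minimizer_cross_pos`). -/

/-! ### The cross product and dot product in coordinates -/

/-- The determinant of two plane vectors. -/
noncomputable def cross (u x : Plane) : ℝ := u 0 * x 1 - u 1 * x 0

/-- The scalar product of two plane vectors, in coordinates. -/
noncomputable def dot (u x : Plane) : ℝ := u 0 * x 0 + u 1 * x 1

/-- The rotation of a plane vector by a right angle. -/
noncomputable def rot (u : Plane) : Plane := !₂[-u 1, u 0]

@[simp] theorem rot_zero_apply (u : Plane) : rot u 0 = -u 1 := by simp [rot]
@[simp] theorem rot_one_apply (u : Plane) : rot u 1 = u 0 := by simp [rot]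

theorem plane_ext {x y : Plane} (h0 : x 0 = y 0) (h1 : x 1 = y 1) : x = y := by
  ext i
  fin_cases i
  · exact h0
  · exact h1

@[simp] theorem cross_add_right (u x y : Plane) : cross u (x + y) = cross u x + cross u y := by
  simp only [cross, PiLp.add_apply]; ring
@[simp] theorem cross_add_left (u x y : Plane) : cross (x + y) u = cross x u + cross y u := by
  simp only [cross, PiLp.add_apply]; ring
@[simp] theorem cross_sub_right (u x y : Plane) : cross u (x - y) = cross u x - cross u y := by
  simp only [cross, PiLp.sub_apply]; ring
@[simp] theorem cross_sub_left (u x y : Plane) : cross (x - y) u = cross x u - cross y u := by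
  simp only [cross, PiLp.sub_apply]; ring
@[simp] theorem cross_smul_right (r : ℝ) (u x : Plane) : cross u (r • x) = r * cross u x := by
  simp only [cross, PiLp.smul_apply, smul_eq_mul]; ring
@[simp] theorem cross_smul_left (r : ℝ) (u x : Plane) : cross (r • u) x = r * cross u x := by
  simp only [cross, PiLp.smul_apply, smul_eq_mul]; ring
@[simp] theorem cross_neg_right (u x : Plane) : cross u (-x) = -cross u x := by
  simp only [cross, PiLp.neg_apply]; ring
@[simp] theorem cross_neg_left (u x : Plane) : cross (-u) x = -cross u x := by
  simp only [cross, PiLp.neg_apply]; ring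
@[simp] theorem cross_same (u : Plane) : cross u u = 0 := by
  simp only [cross]; ring
@[simp] theorem cross_zero_right (u : Plane) : cross u 0 = 0 := by
  simp [cross]
@[simp] theorem cross_zero_left (u : Plane) : cross 0 u = 0 := by
  simp [cross]
theorem cross_swap (u x : Plane) : cross x u = -cross u x := by
  simp only [cross]; ring
theorem cross_rot_self (u : Plane) : cross u (rot u) = dot u u := by
  simp only [cross, dot, rot_zero_apply, rot_one_apply]; ring

theorem continuous_cross (u : Plane) : Continuous (cross u) := by
  unfold cross; fun_prop

theorem dot_self_nonneg (u : Plane) : 0 ≤ dot u u := by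
  unfold dot; nlinarith [sq_nonneg (u 0), sq_nonneg (u 1)]

theorem dot_self_pos {u : Plane} (h : u ≠ 0) : 0 < dot u u := by
  refine lt_of_le_of_ne (dot_self_nonneg u) fun h0 => h ?_
  unfold dot at h0
  refine plane_ext ?_ ?_ <;> simp only [PiLp.zero_apply] <;>
    nlinarith [sq_nonneg (u 0), sq_nonneg (u 1)]

theorem inner_eq_dot (u x : Plane) : inner ℝ u x = dot u x := by
  simp [dot, PiLp.inner_apply, Fin.sum_univ_two, mul_comm]

theorem norm_sq_eq_dot (u : Plane) : ‖u‖ ^ 2 = dot u u := by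
  rw [← real_inner_self_eq_norm_sq, inner_eq_dot]

theorem cross_sq_add_dot_sq (u x : Plane) :
    cross u x ^ 2 + dot u x ^ 2 = dot u u * dot x x := by
  simp only [cross, dot]; ring

theorem eq_smul_of_cross_eq_zero {d x : Plane} (hd : d ≠ 0) (h : cross d x = 0) :
    ∃ s : ℝ, x = s • d := by
  have hp := dot_self_pos hd
  refine ⟨dot d x / dot d d, ?_⟩
  unfold cross at h
  refine plane_ext ?_ ?_ <;> simp only [PiLp.smul_apply, smul_eq_mul] <;> field_simp <;>
    simp only [dot]
  · linear_combination -(d 1) * h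
  · linear_combination (d 0) * h

theorem eq_zero_of_cross_eq_zero {a b x : Plane} (hab : cross a b ≠ 0) (ha : cross a x = 0)
    (hb : cross b x = 0) : x = 0 := by
  unfold cross at *
  refine plane_ext ?_ ?_ <;> simp only [PiLp.zero_apply] <;> apply mul_left_cancel₀ hab
  · linear_combination b 0 * ha - a 0 * hb
  · linear_combination b 1 * ha - a 1 * hb

theorem cross_relation (e₁ e₂ e₃ : Plane) :
    cross e₁ e₂ • e₃ = cross e₁ e₃ • e₂ - cross e₂ e₃ • e₁ := by
  refine plane_ext ?_ ?_ <;>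
    simp only [cross, PiLp.smul_apply, PiLp.sub_apply, smul_eq_mul] <;> ring

/-! ### Zonogons with three generators -/

/-- The zonogon with centre `c` and edge vectors `e₁`, `e₂`, `e₃`. -/
def zonogon (c e₁ e₂ e₃ : Plane) : Set Plane :=
  {y | ∃ x₁ x₂ x₃ : ℝ, |x₁| ≤ 1 / 2 ∧ |x₂| ≤ 1 / 2 ∧ |x₃| ≤ 1 / 2 ∧
    y = c + x₁ • e₁ + x₂ • e₂ + x₃ • e₃}

/-- The area of the zonogon with edge vectors in counterclockwise order. -/
noncomputable def crossSum (e₁ e₂ e₃ : Plane) : ℝ := cross e₁ e₂ + cross e₂ e₃ + cross e₁ e₃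

/-- The edge vectors are in counterclockwise order, within a half turn. -/
structure Ordered (e₁ e₂ e₃ : Plane) : Prop where
  nonneg₁₂ : 0 ≤ cross e₁ e₂
  nonneg₂₃ : 0 ≤ cross e₂ e₃
  nonneg₁₃ : 0 ≤ cross e₁ e₃
  pos : 0 < crossSum e₁ e₂ e₃

/-- The cyclic relabelling of the edges leaves the zonogon and its area unchanged. Facts about the
diagonal `e₁ + e₂` thereby apply to `e₂ + e₃` as well. -/
theorem Ordered.shift {e₁ e₂ e₃ : Plane} (h : Ordered e₁ e₂ e₃) : Ordered e₂ e₃ (-e₁) := by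
  obtain ⟨h1, h2, h3, h4⟩ := h
  unfold crossSum at h4
  have a := cross_swap e₁ e₂
  have b := cross_swap e₁ e₃
  constructor <;> (try simp only [crossSum, cross_neg_right]) <;> linarith

theorem crossSum_shift (e₁ e₂ e₃ : Plane) : crossSum e₂ e₃ (-e₁) = crossSum e₁ e₂ e₃ := by
  simp only [crossSum, cross_neg_right, cross_swap e₁ e₂, cross_swap e₁ e₃]; ring

theorem zonogon_shift (c e₁ e₂ e₃ : Plane) : zonogon c e₂ e₃ (-e₁) = zonogon c e₁ e₂ e₃ := by
  ext y
  constructor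
  · rintro ⟨x, y, z, hx, hy, hz, rfl⟩
    exact ⟨-z, x, y, by rwa [abs_neg], hx, hy, by module⟩
  · rintro ⟨x, y, z, hx, hy, hz, rfl⟩
    exact ⟨y, z, -x, hy, hz, by rwa [abs_neg], by module⟩

/-- If `e₂ = -e₁`, the terms of the area cancel. Hence even a degenerate zonogon has a diagonal
direction along which to symmetrize. -/
theorem Ordered.add_ne_zero {e₁ e₂ e₃ : Plane} (h : Ordered e₁ e₂ e₃) : e₁ + e₂ ≠ 0 := by
  intro h0
  have h2 : e₂ = -e₁ := (neg_eq_of_add_eq_zero_right h0).symm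
  obtain ⟨-, -, -, h4⟩ := h
  subst h2
  simp [crossSum] at h4

/-! ### Zonogons as convex hulls of their corners -/

theorem smul_add_mem_of_convex {K : Set Plane} (hK : Convex ℝ K) {a u : Plane} {x : ℝ}
    (hx : |x| ≤ 1 / 2) (h1 : a + (1 / 2 : ℝ) • u ∈ K) (h2 : a + (-1 / 2 : ℝ) • u ∈ K) :
    a + x • u ∈ K := by
  rw [abs_le] at hx
  have := hK h1 h2 (a := 1 / 2 + x) (b := 1 / 2 - x) (by linarith) (by linarith) (by ring)
  convert this using 1
  module

/-- The sums `c ± e₁ / 2 ± e₂ / 2 ± e₃ / 2`. -/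
def zonogonCorners (c e₁ e₂ e₃ : Plane) : Set Plane :=
  {y | ∃ x₁ ∈ ({1 / 2, -1 / 2} : Set ℝ), ∃ x₂ ∈ ({1 / 2, -1 / 2} : Set ℝ),
    ∃ x₃ ∈ ({1 / 2, -1 / 2} : Set ℝ), c + x₁ • e₁ + x₂ • e₂ + x₃ • e₃ = y}

theorem zonogonCorners_finite (c e₁ e₂ e₃ : Plane) : (zonogonCorners c e₁ e₂ e₃).Finite := by
  have h : ({1 / 2, -1 / 2} : Set ℝ).Finite := Set.toFinite _
  refine ((h.prod (h.prod h)).image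
    fun p : ℝ × ℝ × ℝ => c + p.1 • e₁ + p.2.1 • e₂ + p.2.2 • e₃).subset ?_
  rintro y ⟨x₁, h1, x₂, h2, x₃, h3, rfl⟩
  exact ⟨(x₁, x₂, x₃), ⟨h1, h2, h3⟩, rfl⟩

theorem zonogon_subset_of_convex {K : Set Plane} (hK : Convex ℝ K) {c e₁ e₂ e₃ : Plane}
    (h : zonogonCorners c e₁ e₂ e₃ ⊆ K) : zonogon c e₁ e₂ e₃ ⊆ K := by
  rintro y ⟨x₁, x₂, x₃, h1, h2, h3, rfl⟩
  have A : ∀ x₁ ∈ ({1 / 2, -1 / 2} : Set ℝ), ∀ x₂ ∈ ({1 / 2, -1 / 2} : Set ℝ),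
      c + x₁ • e₁ + x₂ • e₂ + x₃ • e₃ ∈ K := fun x₁ k1 x₂ k2 =>
    smul_add_mem_of_convex hK h3 (h ⟨x₁, k1, x₂, k2, _, by simp, rfl⟩)
      (h ⟨x₁, k1, x₂, k2, _, by simp, rfl⟩)
  have B : ∀ x₁ ∈ ({1 / 2, -1 / 2} : Set ℝ), c + x₁ • e₁ + x₂ • e₂ + x₃ • e₃ ∈ K := by
    intro x₁ k1
    rw [add_right_comm]
    refine smul_add_mem_of_convex hK h2 ?_ ?_ <;> rw [add_right_comm] <;>
      exact A _ k1 _ (by simp)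
  rw [add_assoc, add_right_comm]
  refine smul_add_mem_of_convex hK h1 ?_ ?_ <;> rw [add_right_comm, ← add_assoc] <;>
    exact B _ (by simp)

theorem zonogon_convex (c e₁ e₂ e₃ : Plane) : Convex ℝ (zonogon c e₁ e₂ e₃) := by
  rintro _ ⟨x₁, x₂, x₃, h1, h2, h3, rfl⟩ _ ⟨y₁, y₂, y₃, k1, k2, k3, rfl⟩ a b ha hb hab
  rw [abs_le] at *
  refine ⟨a * x₁ + b * y₁, a * x₂ + b * y₂, a * x₃ + b * y₃, ?_, ?_, ?_, ?_⟩
  · rw [abs_le]; constructor <;> nlinarith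
  · rw [abs_le]; constructor <;> nlinarith
  · rw [abs_le]; constructor <;> nlinarith
  · obtain rfl : b = 1 - a := by linarith
    module

theorem zonogonCorners_subset (c e₁ e₂ e₃ : Plane) :
    zonogonCorners c e₁ e₂ e₃ ⊆ zonogon c e₁ e₂ e₃ := by
  have A : ∀ x ∈ ({1 / 2, -1 / 2} : Set ℝ), |x| ≤ 1 / 2 := by
    rintro x (rfl | rfl)
    · norm_num
    · norm_num [abs_le]
  rintro y ⟨x₁, h1, x₂, h2, x₃, h3, rfl⟩
  exact ⟨x₁, x₂, x₃, A _ h1, A _ h2, A _ h3, rfl⟩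

theorem zonogon_eq_convexHull (c e₁ e₂ e₃ : Plane) :
    zonogon c e₁ e₂ e₃ = convexHull ℝ (zonogonCorners c e₁ e₂ e₃) :=
  (zonogon_subset_of_convex (convex_convexHull _ _) (subset_convexHull _ _)).antisymm
    (convexHull_min (zonogonCorners_subset _ _ _ _) (zonogon_convex _ _ _ _))

theorem zonogon_isCompact (c e₁ e₂ e₃ : Plane) : IsCompact (zonogon c e₁ e₂ e₃) := by
  rw [zonogon_eq_convexHull]
  exact (zonogonCorners_finite c e₁ e₂ e₃).isCompact_convexHull ℝ

/-- Two nonnegative quantities decreasing linearly: the first time at which one of them vanishes. -/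
theorem exists_first_zero {a b u v : ℝ} (ha : 0 ≤ a) (hb : 0 ≤ b) (hu : 0 ≤ u) (hv : 0 ≤ v)
    (huv : 0 < u + v) :
    ∃ t : ℝ, 0 ≤ t ∧ 0 ≤ a - t * u ∧ 0 ≤ b - t * v ∧ (a - t * u = 0 ∨ b - t * v = 0) ∧
      (v = 0 → a - t * u = 0) := by
  rcases hv.eq_or_lt with rfl | hv
  · have hu : 0 < u := by linarith
    have h : a - a / u * u = 0 := by field_simp; ring
    exact ⟨a / u, by positivity, h.ge, by linarith, Or.inl h, fun _ => h⟩
  rcases hu.eq_or_lt with rfl | hu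
  · have h : b - b / v * v = 0 := by field_simp; ring
    exact ⟨b / v, by positivity, by linarith, h.ge, Or.inr h, fun h => absurd h hv.ne'⟩
  have h1 : a - a / u * u = 0 := by field_simp; ring
  have h2 : b - b / v * v = 0 := by field_simp; ring
  rcases le_total (a / u) (b / v) with h | h
  · exact ⟨a / u, by positivity, h1.ge, by nlinarith, Or.inl h1, fun h => absurd h hv.ne'⟩
  · exact ⟨b / v, by positivity, by nlinarith, h2.ge, Or.inr h2, fun h => absurd h hv.ne'⟩

/-- The position of a chord parallel to `e₁ + e₂`: on the central parallelogram, or on one of the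
two triangles. -/
def ChordPos (τ ζ : ℝ) : Prop :=
  (τ = 0 ∧ |ζ| ≤ 1 / 2) ∨ (τ ≤ 0 ∧ ζ = 1 / 2) ∨ (0 ≤ τ ∧ ζ = -1 / 2)

theorem mem_zonogon_of_chordPos {c e₁ e₂ e₃ : Plane} {s τ ζ : ℝ} (h : |s| + |τ| ≤ 1 / 2)
    (hp : ChordPos τ ζ) :
    c + s • (e₁ + e₂) + τ • (e₁ - e₂) + ζ • e₃ ∈ zonogon c e₁ e₂ e₃ := by
  have hz : |ζ| ≤ 1 / 2 := by
    rcases hp with hp | ⟨-, rfl⟩ | ⟨-, rfl⟩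
    · exact hp.2
    · norm_num
    · norm_num [abs_le]
  refine ⟨s + τ, s - τ, ζ, (abs_add_le _ _).trans h, (abs_sub _ _).trans h, hz, by module⟩

theorem exists_chordPos_of_nonneg {c e₁ e₂ e₃ : Plane} (h : Ordered e₁ e₂ e₃) {s τ ζ : ℝ}
    (hs : |s| + |τ| ≤ 1 / 2) (hz : |ζ| ≤ 1 / 2) (hτ : 0 ≤ τ) :
    ∃ s' τ' ζ' : ℝ, |s'| + |τ'| ≤ 1 / 2 ∧ ChordPos τ' ζ' ∧ (cross e₁ e₂ = 0 → τ' = 0) ∧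
      c + s • (e₁ + e₂) + τ • (e₁ - e₂) + ζ • e₃ =
        c + s' • (e₁ + e₂) + τ' • (e₁ - e₂) + ζ' • e₃ := by
  have hr := cross_relation e₁ e₂ e₃
  obtain ⟨h1, h2, h3, h4⟩ := h
  unfold crossSum at h4
  set α := cross e₁ e₂
  set β := cross e₂ e₃
  set γ := cross e₁ e₃
  have hz' := abs_le.1 hz
  -- The relation `α • e₃ = γ • e₂ - β • e₁` leaves a one-parameter freedom in the coordinates of
  -- the point. Move along it, decreasing `τ` and `ζ`, until `τ = 0` or `ζ = -1 / 2`. Since `|γ - β|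
  -- ≤ β + γ`, the sum `|s| + |τ|` does not grow.
  obtain ⟨t, t0, t1, t2, t3, t4⟩ := exists_first_zero hτ (b := ζ + 1 / 2) (by linarith)
    (u := (β + γ) / 2) (v := α) (by linarith) h1 (by linarith)
  refine ⟨s + t * ((γ - β) / 2), τ - t * ((β + γ) / 2), ζ - t * α, ?_, ?_, t4, ?_⟩
  · rw [abs_of_nonneg t1]
    rw [abs_of_nonneg hτ] at hs
    have e1 : |s + t * ((γ - β) / 2)| ≤ |s| + t * ((β + γ) / 2) := by
      refine (abs_add_le _ _).trans ?_
      gcongr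
      rw [abs_mul, abs_of_nonneg t0]
      gcongr
      rw [abs_le]; constructor <;> linarith
    linarith
  · rcases t3 with t3 | t3
    · left
      refine ⟨t3, abs_le.2 ⟨by linarith, ?_⟩⟩
      have : 0 ≤ t * α := by positivity
      linarith
    · right; right
      exact ⟨t1, by linarith⟩
  · have : (t * α) • e₃ = t • (γ • e₂ - β • e₁) := by rw [← hr, smul_smul]
    rw [sub_smul ζ, this]
    module

theorem exists_chordPos {c e₁ e₂ e₃ : Plane} (h : Ordered e₁ e₂ e₃) {y : Plane}
    (hy : y ∈ zonogon c e₁ e₂ e₃) :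
    ∃ s τ ζ : ℝ, |s| + |τ| ≤ 1 / 2 ∧ ChordPos τ ζ ∧ (cross e₁ e₂ = 0 → τ = 0) ∧
      y = c + s • (e₁ + e₂) + τ • (e₁ - e₂) + ζ • e₃ := by
  obtain ⟨x₁, x₂, x₃, h1, h2, h3, rfl⟩ := hy
  rw [abs_le] at h1 h2
  have hs : |(x₁ + x₂) / 2| + |(x₁ - x₂) / 2| ≤ 1 / 2 := by
    rcases abs_cases ((x₁ + x₂) / 2) with a | a <;> rcases abs_cases ((x₁ - x₂) / 2) with b | b <;>
      rw [a.1, b.1] <;> linarith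
  have hy : c + x₁ • e₁ + x₂ • e₂ + x₃ • e₃ =
      c + ((x₁ + x₂) / 2) • (e₁ + e₂) + ((x₁ - x₂) / 2) • (e₁ - e₂) + x₃ • e₃ := by module
  rw [hy]
  rcases le_total 0 ((x₁ - x₂) / 2) with hτ | hτ
  · exact exists_chordPos_of_nonneg h hs h3 hτ
  -- The case `τ ≤ 0` follows by point reflection in the centre.
  · obtain ⟨s, τ, ζ, k1, k2, k3, k4⟩ := exists_chordPos_of_nonneg (c := 0) h
      (s := -((x₁ + x₂) / 2)) (τ := -((x₁ - x₂) / 2)) (ζ := -x₃)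
      (by simpa only [abs_neg] using hs) (by simpa only [abs_neg] using h3) (by linarith)
    refine ⟨-s, -τ, -ζ, by simpa only [abs_neg] using k1, ?_, fun h0 => by simp [k3 h0], ?_⟩
    · rcases k2 with k | k | k
      · exact Or.inl ⟨by linarith [k.1], by rw [abs_neg]; exact k.2⟩
      · exact Or.inr (Or.inr ⟨by linarith [k.1], by linarith [k.2]⟩)
      · exact Or.inr (Or.inl ⟨by linarith [k.1], by linarith [k.2]⟩)
    · have := congrArg (c - ·) k4
      beta_reduce at this
      convert this using 1 <;> module

/-! ### Zonogons tile the plane, and their area -/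

theorem translate_mem_iff {t y : Plane} {H : Set Plane} :
    y ∈ (fun x => t + x) '' H ↔ y - t ∈ H := by
  constructor
  · rintro ⟨x, hx, rfl⟩
    simpa using hx
  · intro h
    exact ⟨y - t, h, by simp⟩

theorem interior_translate (t : Plane) (H : Set Plane) :
    interior ((fun x => t + x) '' H) = (fun x => t + x) '' interior H :=
  ((Homeomorph.addLeft t).image_interior H).symm

theorem cross_add_add_eq_crossSum {e₁ e₂ e₃ : Plane} :
    cross (e₁ + e₂) (e₂ + e₃) = crossSum e₁ e₂ e₃ := by
  simp only [crossSum, cross_add_left, cross_add_right, cross_same]; ring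

/-- The lattice generated by `e₁ + e₂` and `e₂ + e₃` translates the zonogon over the whole plane. -/
theorem zonogon_covers {c e₁ e₂ e₃ : Plane} (h : Ordered e₁ e₂ e₃) (y : Plane) :
    ∃ j k : ℤ, y - ((j : ℝ) • (e₁ + e₂) + (k : ℝ) • (e₂ + e₃)) ∈ zonogon c e₁ e₂ e₃ := by
  have hA := h.pos
  have hAdef : crossSum e₁ e₂ e₃ = cross e₁ e₂ + (cross e₂ e₃ + cross e₁ e₃) := by
    unfold crossSum; ring
  set A := crossSum e₁ e₂ e₃
  have hdb : cross (e₁ + e₂) (e₂ + e₃) = A := cross_add_add_eq_crossSum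
  have hd := h.add_ne_zero
  set η := cross (e₁ + e₂) (y - c) with hη
  set σ := cross e₂ e₃ + cross e₁ e₃ with hσ
  have hσ0 : 0 ≤ σ := add_nonneg h.nonneg₂₃ h.nonneg₁₃
  have hde3 : cross (e₁ + e₂) e₃ = σ := by simp only [cross_add_left]; linarith
  have hdm : cross (e₁ + e₂) (e₁ - e₂) = -2 * cross e₁ e₂ := by
    simp only [cross_add_left, cross_sub_right, cross_same, cross_swap e₁ e₂]; ring
  -- Heights are measured by `cross (e₁ + e₂)`. The central parallelogram occupies `[-σ / 2, σ /
  -- 2]`, and the upper triangle the next interval of length `cross e₁ e₂`. Together they fill one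
  -- period `A`, and `k` brings `y` into it.
  set k := ⌊(η + σ / 2) / A⌋ with hk
  have k1 : (k : ℝ) * A ≤ η + σ / 2 := by
    rw [← le_div_iff₀ hA]; exact Int.floor_le _
  have k2 : η + σ / 2 < (k + 1) * A := by
    rw [← div_lt_iff₀ hA]; exact Int.lt_floor_add_one _
  have hcr : cross (e₁ + e₂) (y - c - (k : ℝ) • (e₂ + e₃)) = η - k * A := by
    rw [cross_sub_right, cross_smul_right, hdb]
  rcases le_or_gt (η - k * A) (σ / 2) with hle | hgt
  · have hζ : ∃ ζ : ℝ, |ζ| ≤ 1 / 2 ∧ ζ * σ = η - k * A := by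
      rcases hσ0.eq_or_lt with h0 | h0
      · exact ⟨0, by norm_num, by rw [← h0] at hle k1 ⊢; linarith⟩
      · refine ⟨(η - k * A) / σ, ?_, by field_simp⟩
        rw [abs_div, abs_of_pos h0, div_le_iff₀ h0, abs_le]
        constructor <;> linarith
    obtain ⟨ζ, z1, z2⟩ := hζ
    obtain ⟨s, hs⟩ := eq_smul_of_cross_eq_zero hd
      (x := y - c - (k : ℝ) • (e₂ + e₃) - ζ • e₃) (by
        rw [cross_sub_right, hcr, cross_smul_right, hde3]; linarith)
    refine ⟨round s, k, ?_⟩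
    have key := mem_zonogon_of_chordPos (c := c) (e₁ := e₁) (e₂ := e₂) (e₃ := e₃)
      (s := s - round s) (τ := 0) (ζ := ζ) (by simpa using abs_sub_round s) (Or.inl ⟨rfl, z1⟩)
    convert key using 1
    have : y = c + (k : ℝ) • (e₂ + e₃) + ζ • e₃ + s • (e₁ + e₂) := by rw [← hs]; abel
    rw [this]; module
  -- In the strip of the upper triangles, the translates by multiples of `e₁ + e₂` leave gaps. These
  -- are filled by the lower triangles of the row `k + 1`.
  · have hα : 0 < cross e₁ e₂ := by nlinarith
    set τ := (η - k * A - σ / 2) / (2 * cross e₁ e₂) with hτ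
    have t0 : 0 < τ := by apply div_pos <;> linarith
    have t1 : τ < 1 / 2 := by
      rw [hτ, div_lt_iff₀ (by linarith)]; linarith
    have t2 : 2 * cross e₁ e₂ * τ = η - k * A - σ / 2 := by rw [hτ]; field_simp
    obtain ⟨s, hs⟩ := eq_smul_of_cross_eq_zero hd
      (x := y - c - (k : ℝ) • (e₂ + e₃) - (1 / 2 : ℝ) • e₃ + τ • (e₁ - e₂)) (by
        rw [cross_add_right, cross_sub_right, hcr, cross_smul_right, hde3, cross_smul_right, hdm]
        linarith)
    have hy : y = c + (k : ℝ) • (e₂ + e₃) + (1 / 2 : ℝ) • e₃ - τ • (e₁ - e₂) +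
        s • (e₁ + e₂) := by rw [← hs]; abel
    set j := ⌊s + (1 / 2 - τ)⌋ with hj
    have j1 : (j : ℝ) ≤ s + (1 / 2 - τ) := Int.floor_le _
    have j2 : s + (1 / 2 - τ) < j + 1 := Int.lt_floor_add_one _
    rcases le_or_gt (s - j) (1 / 2 - τ) with hsj | hsj
    · refine ⟨j, k, ?_⟩
      have key := mem_zonogon_of_chordPos (c := c) (e₁ := e₁) (e₂ := e₂) (e₃ := e₃)
        (s := s - j) (τ := -τ) (ζ := 1 / 2) (by
          rw [abs_neg, abs_of_pos t0]
          have : |s - j| ≤ 1 / 2 - τ := abs_le.2 ⟨by linarith, hsj⟩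
          linarith) (Or.inr (Or.inl ⟨by linarith, rfl⟩))
      convert key using 1
      rw [hy]; module
    · refine ⟨j, k + 1, ?_⟩
      have key := mem_zonogon_of_chordPos (c := c) (e₁ := e₁) (e₂ := e₂) (e₃ := e₃)
        (s := s - j - 1 / 2) (τ := 1 / 2 - τ) (ζ := -1 / 2) (by
          rw [abs_of_nonneg (a := 1 / 2 - τ) (by linarith)]
          have : |s - j - 1 / 2| ≤ τ := abs_le.2 ⟨by linarith, by linarith⟩
          linarith) (Or.inr (Or.inr ⟨by linarith, rfl⟩))
      convert key using 1
      rw [hy]; push_cast; module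

theorem abs_lt_of_mem_interior {Z : Set Plane} {c u x : Plane} {B : ℝ} (hu : u ≠ 0)
    (hB : ∀ y ∈ Z, |cross u (y - c)| ≤ B) (hx : x ∈ interior Z) : |cross u (x - c)| < B := by
  have hp := dot_self_pos hu
  have hcont : Continuous fun ε : ℝ => x + ε • rot u := by fun_prop
  have hnhds : ∀ᶠ ε : ℝ in nhds 0, x + ε • rot u ∈ Z := by
    have : Z ∈ nhds (x + (0 : ℝ) • rot u) := by
      simpa using mem_interior_iff_mem_nhds.1 hx
    exact hcont.continuousAt this
  obtain ⟨δ, δ0, hδ⟩ := Metric.eventually_nhds_iff.1 hnhds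
  have a1 := hB _ (hδ (y := δ / 2) (by simp [abs_of_pos δ0]; linarith))
  have a2 := hB _ (hδ (y := -(δ / 2)) (by simp [abs_of_pos δ0]; linarith))
  have e : ∀ ε : ℝ, cross u (x + ε • rot u - c) = cross u (x - c) + ε * dot u u := by
    intro ε
    simp only [cross_sub_right, cross_add_right, cross_smul_right, cross_rot_self]; ring
  rw [e, abs_le] at a1 a2
  have : 0 < δ / 2 * dot u u := by positivity
  rw [abs_lt]
  constructor <;> linarith

theorem abs_comb_le {x y z a b c : ℝ} (hx : |x| ≤ 1 / 2) (hy : |y| ≤ 1 / 2) (hz : |z| ≤ 1 / 2) :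
    |x * a + y * b + z * c| ≤ (|a| + |b| + |c|) / 2 := by
  refine (abs_add_three _ _ _).trans ?_
  simp only [abs_mul]
  nlinarith [abs_nonneg a, abs_nonneg b, abs_nonneg c]

/-- The width bound of a zonogon, in any direction. -/
theorem abs_cross_zonogon_le {c e₁ e₂ e₃ y : Plane} (u : Plane) (hy : y ∈ zonogon c e₁ e₂ e₃) :
    |cross u (y - c)| ≤ (|cross u e₁| + |cross u e₂| + |cross u e₃|) / 2 := by
  obtain ⟨x₁, x₂, x₃, h1, h2, h3, rfl⟩ := hy
  have : cross u (c + x₁ • e₁ + x₂ • e₂ + x₃ • e₃ - c) =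
      x₁ * cross u e₁ + x₂ * cross u e₂ + x₃ * cross u e₃ := by
    simp only [cross_sub_right, cross_add_right, cross_smul_right]; ring
  rw [this]
  exact abs_comb_le h1 h2 h3

/-- If a tile and its translate by `t` overlap at a point interior to the first, then `t` is shorter
than the width of the tile, measured along `cross u`. -/
theorem abs_cross_translation_lt {c e₁ e₂ e₃ u t x : Plane} (hu : u ≠ 0)
    (hx : x ∈ interior (zonogon c e₁ e₂ e₃)) (hxt : x - t ∈ zonogon c e₁ e₂ e₃) :
    |cross u t| < |cross u e₁| + |cross u e₂| + |cross u e₃| := by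
  have h1 := abs_lt_of_mem_interior hu (fun y hy => abs_cross_zonogon_le u hy) hx
  have h2 := abs_cross_zonogon_le u hxt
  have : cross u t = cross u (x - c) - cross u (x - t - c) := by
    simp only [cross_sub_right]; ring
  rw [this]
  refine (abs_sub _ _).trans_lt ?_
  linarith

/-- Measured by `cross eᵢ`, some edge vector `eᵢ` sees the lattice vector at least as long as the
zonogon is wide. Up to sign there are three ranges of `(j, k)`, one for each edge. -/
theorem zonogon_lattice_disjoint {c e₁ e₂ e₃ : Plane} (h : Ordered e₁ e₂ e₃) {j k : ℤ}
    (hjk : ¬(j = 0 ∧ k = 0)) {x : Plane} (hx : x ∈ interior (zonogon c e₁ e₂ e₃)) :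
    x - ((j : ℝ) • (e₁ + e₂) + (k : ℝ) • (e₂ + e₃)) ∉ zonogon c e₁ e₂ e₃ := by
  intro hxt
  have f1 := fun hu => abs_cross_translation_lt (u := e₁) hu hx hxt
  have f2 := fun hu => abs_cross_translation_lt (u := e₂) hu hx hxt
  have f3 := fun hu => abs_cross_translation_lt (u := e₃) hu hx hxt
  have z1 : e₁ = 0 → cross e₁ e₂ = 0 ∧ cross e₁ e₃ = 0 := by rintro rfl; simp
  have z2 : e₂ = 0 → cross e₁ e₂ = 0 ∧ cross e₂ e₃ = 0 := by rintro rfl; simp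
  have z3 : e₃ = 0 → cross e₁ e₃ = 0 ∧ cross e₂ e₃ = 0 := by rintro rfl; simp
  simp only [cross_add_right, cross_smul_right, cross_same, cross_swap e₁ e₂, cross_swap e₁ e₃,
    cross_swap e₂ e₃, abs_neg, abs_zero] at f1 f2 f3
  obtain ⟨p1, p2, p3, p4⟩ := h
  unfold crossSum at p4
  rw [abs_of_nonneg p1, abs_of_nonneg p3] at f1
  rw [abs_of_nonneg p1, abs_of_nonneg p2] at f2
  rw [abs_of_nonneg p2, abs_of_nonneg p3] at f3
  set α := cross e₁ e₂
  set β := cross e₂ e₃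
  set γ := cross e₁ e₃
  clear_value α β γ
  have g1 : 0 < α + γ → |(j : ℝ) * α + k * (α + γ)| < α + γ := by
    intro hp
    have := f1 fun h0 => by have := z1 h0; linarith
    simpa using this
  have g2 : 0 < α + β → |(j : ℝ) * -α + k * β| < α + β := by
    intro hp
    have := f2 fun h0 => by have := z2 h0; linarith
    simpa using this
  have g3 : 0 < β + γ → |(j : ℝ) * (γ + β) + k * β| < β + γ := by
    intro hp
    have := f3 fun h0 => by have := z3 h0; linarith
    have e : (j : ℝ) * (γ + β) + k * β = -((j : ℝ) * (-γ + -β) + k * (-β + 0)) := by ring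
    rw [e, abs_neg]
    linarith
  simp only [abs_lt] at g1 g2 g3
  have key : ∀ J K : ℝ, (1 ≤ J ∧ K ≤ -1) ∨ (0 ≤ J ∧ 1 ≤ K) ∨ (1 ≤ J ∧ K = 0) →
      (0 < α + γ → -(α + γ) < J * α + K * (α + γ) ∧ J * α + K * (α + γ) < α + γ) →
      (0 < α + β → -(α + β) < J * -α + K * β ∧ J * -α + K * β < α + β) →
      (0 < β + γ → -(β + γ) < J * (γ + β) + K * β ∧ J * (γ + β) + K * β < β + γ) → False := by
    intro J K hJK q1 q2 q3
    rcases hJK with ⟨a, b⟩ | ⟨a, b⟩ | ⟨a, rfl⟩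
    -- The edge meant for this range is useless if the width in its direction is zero. Two of the
    -- determinants then vanish, and another edge separates the tiles.
    · rcases (add_nonneg p1 p2).eq_or_lt with h0 | h0
      · have hα : α = 0 := by linarith
        have := (q1 (by linarith)).1
        rw [hα] at this
        nlinarith
      · have := (q2 h0).1
        nlinarith
    · rcases (add_nonneg p1 p3).eq_or_lt with h0 | h0
      · have hα : α = 0 := by linarith
        have := (q2 (by linarith)).2
        rw [hα] at this
        nlinarith
      · have := (q1 h0).2
        nlinarith
    · rcases (add_nonneg p2 p3).eq_or_lt with h0 | h0
      · have := (q1 (by linarith)).2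
        nlinarith
      · have := (q3 h0).2
        nlinarith
  have cases : ((1 ≤ j ∧ k ≤ -1) ∨ (0 ≤ j ∧ 1 ≤ k) ∨ (1 ≤ j ∧ k = 0)) ∨
      ((1 ≤ -j ∧ -k ≤ -1) ∨ (0 ≤ -j ∧ 1 ≤ -k) ∨ (1 ≤ -j ∧ -k = 0)) := by omega
  rcases cases with hc | hc
  · exact key j k (by exact_mod_cast hc) g1 g2 g3
  · refine key (-j) (-k) (by exact_mod_cast hc) ?_ ?_ ?_
    · intro h0
      constructor <;> linarith [g1 h0]
    · intro h0
      constructor <;> linarith [g2 h0]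
    · intro h0
      constructor <;> linarith [g3 h0]

theorem zonogon_tessellates {c e₁ e₂ e₃ : Plane} (h : Ordered e₁ e₂ e₃) :
    TessellatesByTranslations (zonogon c e₁ e₂ e₃) := by
  refine ⟨{t | ∃ j k : ℤ, t = (j : ℝ) • (e₁ + e₂) + (k : ℝ) • (e₂ + e₃)}, ?_, ?_⟩
  · refine Set.eq_univ_of_forall fun y => ?_
    obtain ⟨j, k, hjk⟩ := zonogon_covers (c := c) h y
    exact Set.mem_biUnion ⟨j, k, rfl⟩ (translate_mem_iff.2 hjk)
  · rintro _ ⟨j, k, rfl⟩ _ ⟨j', k', rfl⟩ hne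
    rw [Function.onFun, Set.disjoint_left]
    intro x hx hx'
    rw [interior_translate, translate_mem_iff] at hx hx'
    refine zonogon_lattice_disjoint h (j := j' - j) (k := k' - k) ?_ hx ?_
    · rintro ⟨h1, h2⟩
      apply hne
      rw [show j' = j by omega, show k' = k by omega]
    · convert interior_subset hx' using 1
      push_cast; module

/-! ### The area of a zonogon as the determinant of its lattice -/

theorem linearIndependent_pair_of_cross {a b : Plane} (h : cross a b ≠ 0) :
    LinearIndependent ℝ ![a, b] := by
  rw [LinearIndependent.pair_iff]
  intro s t hst
  have h1 := congrArg (cross a) hst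
  have h2 := congrArg (fun z => cross z b) hst
  simp only [cross_add_right, cross_add_left, cross_smul_right, cross_smul_left, cross_same,
    cross_zero_right, cross_zero_left, mul_zero, zero_add, add_zero, mul_eq_zero] at h1 h2
  exact ⟨h2.resolve_right h, h1.resolve_right h⟩

/-- The basis of the plane given by two independent vectors. -/
noncomputable def pairBasis {a b : Plane} (h : cross a b ≠ 0) : Module.Basis (Fin 2) ℝ Plane :=
  basisOfLinearIndependentOfCardEqFinrank (linearIndependent_pair_of_cross h) (by simp)

theorem range_pairBasis {a b : Plane} (h : cross a b ≠ 0) :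
    Set.range (pairBasis h) = {a, b} := by
  simp [pairBasis, Matrix.range_cons, Set.pair_comm]

theorem mem_span_pairBasis {a b : Plane} (h : cross a b ≠ 0) {t : Plane} :
    t ∈ Submodule.span ℤ (Set.range (pairBasis h)) ↔
      ∃ j k : ℤ, (j : ℝ) • a + (k : ℝ) • b = t := by
  rw [range_pairBasis, Submodule.mem_span_pair]
  simp only [Int.cast_smul_eq_zsmul]

open MeasureTheory in
theorem volume_fundamentalDomain_pairBasis {a b : Plane} (h : cross a b ≠ 0) :
    volume (ZSpan.fundamentalDomain (pairBasis h)) = ENNReal.ofReal |cross a b| := by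
  have h0 : volume (ZSpan.fundamentalDomain (EuclideanSpace.basisFun (Fin 2) ℝ).toBasis) = 1 := by
    rw [measure_congr (ZSpan.fundamentalDomain_ae_parallelepiped _ volume)]
    rw [OrthonormalBasis.coe_toBasis]
    exact OrthonormalBasis.volume_parallelepiped _
  rw [ZSpan.measure_fundamentalDomain (pairBasis h) volume
    (EuclideanSpace.basisFun (Fin 2) ℝ).toBasis, h0, mul_one]
  congr 2
  rw [Module.Basis.det_apply, Matrix.det_fin_two]
  simp [Module.Basis.toMatrix_apply, pairBasis, cross]
  ring

-- The zonogon and the lattice parallelogram are fundamental domains of the same lattice, so their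
-- areas agree.
open MeasureTheory in
theorem volume_zonogon {c e₁ e₂ e₃ : Plane} (h : Ordered e₁ e₂ e₃) :
    volume (zonogon c e₁ e₂ e₃) = ENNReal.ofReal (crossSum e₁ e₂ e₃) := by
  have hcr : cross (e₁ + e₂) (e₂ + e₃) ≠ 0 := by rw [cross_add_add_eq_crossSum]; exact h.pos.ne'
  have hfr : volume (frontier (zonogon c e₁ e₂ e₃)) = 0 :=
    (zonogon_convex c e₁ e₂ e₃).addHaar_frontier volume
  have : Countable (Submodule.span ℤ (Set.range (pairBasis hcr))).toAddSubgroup := by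
    refine Set.Countable.to_subtype ((Set.countable_range fun p : ℤ × ℤ =>
      (p.1 : ℝ) • (e₁ + e₂) + (p.2 : ℝ) • (e₂ + e₃)).mono fun t ht => ?_)
    obtain ⟨j, k, rfl⟩ := (mem_span_pairBasis hcr).1 ht
    exact ⟨(j, k), rfl⟩
  have hfd : IsAddFundamentalDomain
      (Submodule.span ℤ (Set.range (pairBasis hcr))).toAddSubgroup
      (zonogon c e₁ e₂ e₃) volume := by
    refine ⟨(zonogon_isCompact c e₁ e₂ e₃).measurableSet.nullMeasurableSet, ?_, ?_⟩
    · refine Filter.Eventually.of_forall fun y => ?_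
      obtain ⟨j, k, hjk⟩ := zonogon_covers (c := c) h y
      refine ⟨⟨-((j : ℝ) • (e₁ + e₂) + (k : ℝ) • (e₂ + e₃)), ?_⟩, ?_⟩
      · exact neg_mem ((mem_span_pairBasis hcr).2 ⟨j, k, rfl⟩)
      · convert hjk using 1
        change -((j : ℝ) • (e₁ + e₂) + (k : ℝ) • (e₂ + e₃)) + y = _
        abel
    · rintro ⟨g, hg⟩ ⟨g', hg'⟩ hne
      obtain ⟨j, k, rfl⟩ := (mem_span_pairBasis hcr).1 hg
      obtain ⟨j', k', rfl⟩ := (mem_span_pairBasis hcr).1 hg'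
      change volume (_ ∩ _) = 0
      -- Two distinct translates meet only inside a translate of the frontier, which is null by
      -- convexity.
      refine measure_mono_null ?_
        ((measure_preimage_add volume (-((j : ℝ) • (e₁ + e₂) + (k : ℝ) • (e₂ + e₃))) _).trans hfr)
      rintro _ ⟨⟨x, hx, rfl⟩, ⟨x', hx', hxx'⟩⟩
      change (j' : ℝ) • (e₁ + e₂) + (k' : ℝ) • (e₂ + e₃) + x' =
        (j : ℝ) • (e₁ + e₂) + (k : ℝ) • (e₂ + e₃) + x at hxx'
      change -((j : ℝ) • (e₁ + e₂) + (k : ℝ) • (e₂ + e₃)) +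
        ((j : ℝ) • (e₁ + e₂) + (k : ℝ) • (e₂ + e₃) + x) ∈
          frontier (zonogon c e₁ e₂ e₃)
      rw [neg_add_cancel_left]
      refine ⟨subset_closure hx, fun hxi => ?_⟩
      refine zonogon_lattice_disjoint h (j := j' - j) (k := k' - k) ?_ hxi ?_
      · rintro ⟨h1, h2⟩
        apply hne
        congr 4 <;> omega
      · convert hx' using 1
        rw [← sub_eq_iff_eq_add'.2 hxx'.symm]
        push_cast; module
  rw [hfd.measure_eq (ZSpan.isAddFundamentalDomain (pairBasis hcr) volume),
    volume_fundamentalDomain_pairBasis, cross_add_add_eq_crossSum, abs_of_pos h.pos]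

/-- With empty interior the zonogon would equal its own frontier, which is null, although its area
is positive. -/
theorem zonogon_interior_nonempty {c e₁ e₂ e₃ : Plane} (h : Ordered e₁ e₂ e₃) :
    (interior (zonogon c e₁ e₂ e₃)).Nonempty := by
  by_contra hne
  rw [Set.not_nonempty_iff_eq_empty] at hne
  have hfr : MeasureTheory.volume (frontier (zonogon c e₁ e₂ e₃)) = 0 :=
    (zonogon_convex c e₁ e₂ e₃).addHaar_frontier MeasureTheory.volume
  rw [frontier, hne, Set.sdiff_empty, (zonogon_isCompact c e₁ e₂ e₃).isClosed.closure_eq,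
    volume_zonogon h, ENNReal.ofReal_eq_zero] at hfr
  exact absurd h.pos hfr.not_gt

theorem zonogon_mem_translationTiles {c e₁ e₂ e₃ : Plane} (h : Ordered e₁ e₂ e₃) :
    zonogon c e₁ e₂ e₃ ∈ TranslationTiles := by
  refine ⟨⟨⟨(zonogonCorners_finite c e₁ e₂ e₃).toFinset, ?_⟩, zonogon_interior_nonempty h⟩,
    zonogon_tessellates h⟩
  rw [Set.Finite.coe_toFinset]
  exact zonogon_eq_convexHull c e₁ e₂ e₃

/-! ### Steiner symmetrization of zonogons parallel to a short diagonal -/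

/-- The orthogonal projection along the unit vector `v`. -/
noncomputable def perpProj (v x : Plane) : Plane := cross v x • rot v

theorem dot_self_of_norm_eq_one {v : Plane} (hv : ‖v‖ = 1) : dot v v = 1 := by
  rw [← norm_sq_eq_dot, hv]; norm_num

theorem eq_dot_smul_add_perpProj {v : Plane} (hv : ‖v‖ = 1) (x : Plane) :
    x = dot x v • v + perpProj v x := by
  have h := dot_self_of_norm_eq_one hv
  unfold dot at h
  refine plane_ext ?_ ?_ <;> simp only [perpProj, dot, cross, PiLp.add_apply, PiLp.smul_apply,
    smul_eq_mul, rot_zero_apply, rot_one_apply]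
  · linear_combination -(x 0) * h
  · linear_combination -(x 1) * h

theorem dot_perpProj (v x : Plane) : dot (perpProj v x) v = 0 := by
  simp only [perpProj, dot, PiLp.smul_apply, smul_eq_mul, rot_zero_apply, rot_one_apply]; ring

theorem cross_perpProj {v : Plane} (hv : ‖v‖ = 1) (x : Plane) :
    cross v (perpProj v x) = cross v x := by
  rw [perpProj, cross_smul_right, cross_rot_self, dot_self_of_norm_eq_one hv, mul_one]

theorem cross_perpProj_perpProj (v x y : Plane) : cross (perpProj v x) (perpProj v y) = 0 := by
  simp [perpProj, cross_same]

theorem perpProj_add (v x y : Plane) : perpProj v (x + y) = perpProj v x + perpProj v y := by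
  simp only [perpProj, cross_add_right, add_smul]

theorem perpProj_smul (v : Plane) (r : ℝ) (x : Plane) :
    perpProj v (r • x) = r • perpProj v x := by
  simp only [perpProj, cross_smul_right, mul_smul]

theorem perpProj_self (v : Plane) : perpProj v v = 0 := by
  simp [perpProj, cross_same]

theorem dot_perpProj_self {v : Plane} (hv : ‖v‖ = 1) (x : Plane) :
    dot (perpProj v x) (perpProj v x) = dot x x - dot x v ^ 2 := by
  have h := dot_self_of_norm_eq_one hv
  have h2 := cross_sq_add_dot_sq v x
  have h3 : dot x v = dot v x := by simp only [dot]; ring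
  have h4 : dot (perpProj v x) (perpProj v x) = cross v x ^ 2 * dot v v := by
    simp only [perpProj, dot, PiLp.smul_apply, smul_eq_mul, rot_zero_apply, rot_one_apply]; ring
  rw [h4, h3, h]; rw [h] at h2; linarith

theorem hausdorffMeasure_segment {v : Plane} (hv : ‖v‖ = 1) (x : Plane) (g : ℝ) {ρ : ℝ} :
    MeasureTheory.Measure.hausdorffMeasure 1 ((fun r : ℝ => x + r • v) '' Set.Icc (g - ρ) (g + ρ)) =
      ENNReal.ofReal (2 * ρ) := by
  have hiso : Isometry fun r : ℝ => x + r • v := by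
    refine Isometry.of_dist_eq fun a b => ?_
    rw [dist_add_left, dist_eq_norm, ← sub_smul, norm_smul, hv, mul_one, ← dist_eq_norm]
  rw [hiso.hausdorffMeasure_image (Or.inl zero_le_one), MeasureTheory.hausdorffMeasure_real,
    Real.volume_Icc]
  congr 1; ring

/-- The admissible pairs `(τ, ζ)` form a descending staircase. Along it the height of the chord is
monotone in each of the two coordinates. -/
theorem chordPos_comparable {τ ζ τ' ζ' : ℝ} (h : ChordPos τ ζ) (h' : ChordPos τ' ζ') :
    (τ ≤ τ' ∧ ζ' ≤ ζ) ∨ (τ' ≤ τ ∧ ζ ≤ ζ') := by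
  unfold ChordPos at h h'
  simp only [abs_le] at h h'
  rcases h with ⟨a, b⟩ | ⟨a, b⟩ | ⟨a, b⟩ <;> rcases h' with ⟨a', b'⟩ | ⟨a', b'⟩ | ⟨a', b'⟩ <;>
    rcases le_total τ τ' with k | k <;> rcases le_total ζ ζ' with l | l <;>
    first
      | exact Or.inl ⟨by linarith, by linarith⟩
      | exact Or.inr ⟨by linarith, by linarith⟩

/-- The position of a chord is determined by the line it lies on. -/
theorem Ordered.chordPos_unique {c e₁ e₂ e₃ : Plane} (h : Ordered e₁ e₂ e₃)
    {s τ ζ s' τ' ζ' r : ℝ} (hp : ChordPos τ ζ) (hp' : ChordPos τ' ζ')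
    (hτ : cross e₁ e₂ = 0 → τ = 0) (hτ' : cross e₁ e₂ = 0 → τ' = 0)
    (heq : c + s' • (e₁ + e₂) + τ' • (e₁ - e₂) + ζ' • e₃ =
      c + s • (e₁ + e₂) + τ • (e₁ - e₂) + ζ • e₃ + r • (e₁ + e₂)) :
    τ' = τ ∧ s' = s + r := by
  have hc := congrArg (cross (e₁ + e₂)) heq
  simp only [cross_add_left, cross_add_right, cross_smul_right, cross_sub_right, cross_same,
    cross_swap e₁ e₂] at hc
  have hz : (ζ' - ζ) • e₃ = 0 ∧ τ' = τ := by
    obtain ⟨h1, h2, h3, h4⟩ := h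
    unfold crossSum at h4
    have hsum : 2 * cross e₁ e₂ * (τ' - τ) = (cross e₂ e₃ + cross e₁ e₃) * (ζ' - ζ) := by
      linarith
    -- By comparability both sides of `hsum` have opposite signs, so both vanish.
    have hboth : cross e₁ e₂ * (τ' - τ) = 0 ∧ (cross e₂ e₃ + cross e₁ e₃) * (ζ' - ζ) = 0 := by
      have h23 : 0 ≤ cross e₂ e₃ + cross e₁ e₃ := by linarith
      rcases chordPos_comparable hp hp' with ⟨k, l⟩ | ⟨k, l⟩
      · have p := mul_nonneg h1 (sub_nonneg.2 k)
        have q := mul_nonneg h23 (sub_nonneg.2 l)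
        constructor <;> linarith
      · have p := mul_nonneg h1 (sub_nonneg.2 k)
        have q := mul_nonneg h23 (sub_nonneg.2 l)
        constructor <;> linarith
    refine ⟨?_, ?_⟩
    · rcases mul_eq_zero.1 hboth.2 with k | k
      · have k1 : cross e₂ e₃ = 0 := by linarith
        have k2 : cross e₁ e₃ = 0 := by linarith
        rw [eq_zero_of_cross_eq_zero (x := e₃) (by linarith : cross e₁ e₂ ≠ 0) k2 k1, smul_zero]
      · rw [k, zero_smul]
    · rcases mul_eq_zero.1 hboth.1 with k | k
      · rw [hτ k, hτ' k]
      · linarith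
  obtain ⟨hz, rfl⟩ := hz
  refine ⟨rfl, ?_⟩
  have : (s' - s - r) • (e₁ + e₂) = -((ζ' - ζ) • e₃) := by
    have := sub_eq_zero.2 heq
    rw [← sub_eq_zero, ← this]; module
  rw [hz, neg_zero, smul_eq_zero] at this
  rcases this with k | k
  · linarith
  · exact absurd k h.add_ne_zero

/-- The chord of a zonogon parallel to `e₁ + e₂`, on the line through a point of the zonogon. -/
theorem Ordered.chord_eq {c e₁ e₂ e₃ v x : Plane} (h : Ordered e₁ e₂ e₃) {L s τ ζ g : ℝ}
    (hL : 0 < L) (hd : e₁ + e₂ = L • v) (hs : |s| + |τ| ≤ 1 / 2) (hp : ChordPos τ ζ)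
    (hτ : cross e₁ e₂ = 0 → τ = 0) (hg : c + τ • (e₁ - e₂) + ζ • e₃ = x + g • v) :
    zonogon c e₁ e₂ e₃ ∩ normalLine v x =
      (fun r : ℝ => x + r • v) '' Set.Icc (g - L * (1 / 2 - |τ|)) (g + L * (1 / 2 - |τ|)) := by
  ext y
  constructor
  · rintro ⟨hy, r, rfl⟩
    obtain ⟨s', τ', ζ', k1, k2, k3, k4⟩ := exists_chordPos h hy
    obtain ⟨rfl, k5⟩ := h.chordPos_unique (c := c) (s := s) (r := (r - g) / L - s) hp k2 hτ k3 (by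
      rw [← k4, hd]
      have e : c + s • L • v + τ • (e₁ - e₂) + ζ • e₃ = x + g • v + s • L • v := by
        rw [← hg]; abel
      have e2 : (r - g) = (r - g) / L * L := by field_simp
      rw [e, show x + r • v = x + g • v + (r - g) • v by module]
      conv_lhs => rw [e2]
      module)
    have hs' : s' = (r - g) / L := by linarith
    have : |(r - g) / L| ≤ 1 / 2 - |τ'| := by rw [← hs']; linarith
    rw [abs_div, abs_of_pos hL, div_le_iff₀ hL, abs_le] at this
    exact ⟨r, ⟨by linarith, by linarith⟩, rfl⟩
  · rintro ⟨r, ⟨h1, h2⟩, rfl⟩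
    refine ⟨?_, r, rfl⟩
    have key := mem_zonogon_of_chordPos (c := c) (e₁ := e₁) (e₂ := e₂) (e₃ := e₃)
      (s := (r - g) / L) (τ := τ) (ζ := ζ) (by
        have : |(r - g) / L| ≤ 1 / 2 - |τ| := by
          rw [abs_div, abs_of_pos hL, div_le_iff₀ hL, abs_le]
          constructor <;> linarith
        linarith) hp
    convert key using 1
    have e : c + ((r - g) / L) • (e₁ + e₂) + τ • (e₁ - e₂) + ζ • e₃ =
      x + g • v + ((r - g) / L) • L • v := by rw [← hg, hd]; abel
    have e2 : (r - g) / L * L = r - g := by field_simp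
    rw [e, smul_smul, e2]; module

/-- The first edge vector of the symmetrized zonogon. -/
noncomputable def symmEdge₁ (v e₁ e₂ : Plane) : Plane :=
  (1 / 2 : ℝ) • (e₁ + e₂) + (1 / 2 : ℝ) • perpProj v (e₁ - e₂)

/-- The second edge vector of the symmetrized zonogon. -/
noncomputable def symmEdge₂ (v e₁ e₂ : Plane) : Plane :=
  (1 / 2 : ℝ) • (e₁ + e₂) - (1 / 2 : ℝ) • perpProj v (e₁ - e₂)

theorem symmEdge_add (v e₁ e₂ : Plane) : symmEdge₁ v e₁ e₂ + symmEdge₂ v e₁ e₂ = e₁ + e₂ := by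
  unfold symmEdge₁ symmEdge₂; module

theorem symmEdge_sub (v e₁ e₂ : Plane) :
    symmEdge₁ v e₁ e₂ - symmEdge₂ v e₁ e₂ = perpProj v (e₁ - e₂) := by
  unfold symmEdge₁ symmEdge₂; module

theorem symmEdge_cross {v e₁ e₂ e₃ : Plane} (hv : ‖v‖ = 1) {L : ℝ} (hd : e₁ + e₂ = L • v) :
    cross (symmEdge₁ v e₁ e₂) (symmEdge₂ v e₁ e₂) = cross e₁ e₂ ∧
    cross (symmEdge₂ v e₁ e₂) (perpProj v e₃) = (cross e₂ e₃ + cross e₁ e₃) / 2 ∧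
    cross (symmEdge₁ v e₁ e₂) (perpProj v e₃) = (cross e₂ e₃ + cross e₁ e₃) / 2 := by
  have hP : ∀ x, cross (e₁ + e₂) (perpProj v x) = cross (e₁ + e₂) x := by
    intro x
    rw [hd, cross_smul_left, cross_smul_left, cross_perpProj hv]
  refine ⟨?_, ?_, ?_⟩
  · have : cross (symmEdge₁ v e₁ e₂) (symmEdge₂ v e₁ e₂) =
        -(1 / 2) * cross (e₁ + e₂) (perpProj v (e₁ - e₂)) := by
      simp only [symmEdge₁, symmEdge₂, cross_add_left _ ((1 / 2 : ℝ) • (e₁ + e₂)),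
        cross_sub_right, cross_smul_left, cross_smul_right, cross_same,
        cross_swap (e₁ + e₂) (perpProj v (e₁ - e₂))]
      ring
    rw [this, hP]
    simp only [cross_add_left, cross_sub_right, cross_same, cross_swap e₁ e₂]; ring
  · rw [symmEdge₂, cross_sub_left, cross_smul_left, cross_smul_left, cross_perpProj_perpProj, hP,
      cross_add_left]
    ring
  · rw [symmEdge₁, cross_add_left, cross_smul_left, cross_smul_left, cross_perpProj_perpProj, hP,
      cross_add_left]
    ring

theorem Ordered.symm {v e₁ e₂ e₃ : Plane} (h : Ordered e₁ e₂ e₃) (hv : ‖v‖ = 1) {L : ℝ}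
    (hd : e₁ + e₂ = L • v) :
    Ordered (symmEdge₁ v e₁ e₂) (symmEdge₂ v e₁ e₂) (perpProj v e₃) ∧
      crossSum (symmEdge₁ v e₁ e₂) (symmEdge₂ v e₁ e₂) (perpProj v e₃) = crossSum e₁ e₂ e₃ := by
  obtain ⟨a, b, g⟩ := symmEdge_cross (e₃ := e₃) hv hd
  have hs : crossSum (symmEdge₁ v e₁ e₂) (symmEdge₂ v e₁ e₂) (perpProj v e₃) =
      crossSum e₁ e₂ e₃ := by
    unfold crossSum; rw [a, b, g]; ring
  obtain ⟨h1, h2, h3, h4⟩ := h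
  exact ⟨⟨by rw [a]; exact h1, by rw [b]; linarith, by rw [g]; linarith, by rw [hs]; exact h4⟩, hs⟩

/-- The centre of a chord is affine in `(τ, ζ)` and its half-length depends only on `τ`. Projecting
the centres keeps this form, with `e₁ - e₂` and `e₃` projected and `e₁ + e₂` unchanged. -/
theorem steinerSymm_zonogon {c e₁ e₂ e₃ v : Plane} (h : Ordered e₁ e₂ e₃) {L : ℝ} (hv : ‖v‖ = 1)
    (hL : 0 < L) (hd : e₁ + e₂ = L • v) :
    steinerSymm v (zonogon c e₁ e₂ e₃) =
      zonogon (perpProj v c) (symmEdge₁ v e₁ e₂) (symmEdge₂ v e₁ e₂) (perpProj v e₃) := by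
  have hproj : ∀ τ ζ : ℝ, perpProj v (c + τ • (e₁ - e₂) + ζ • e₃) =
      perpProj v c + τ • perpProj v (e₁ - e₂) + ζ • perpProj v e₃ := by
    intro τ ζ; simp only [perpProj_add, perpProj_smul]
  have hlen : ∀ r ρ : ℝ, 0 ≤ ρ → (ENNReal.ofReal (2 * |r|) ≤ ENNReal.ofReal (2 * ρ) ↔ |r| ≤ ρ) := by
    intro r ρ hρ
    rw [ENNReal.ofReal_le_ofReal_iff (by positivity)]
    constructor <;> intro <;> linarith
  ext y
  constructor
  · rintro ⟨x, r, hx, ⟨y₀, ⟨t, rfl⟩, hy₀⟩, hr, rfl⟩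
    rw [inner_eq_dot] at hx
    obtain ⟨s, τ, ζ, k1, k2, k3, k4⟩ := exists_chordPos h hy₀
    have hC : c + τ • (e₁ - e₂) + ζ • e₃ = x + (t - s * L) • v := by
      rw [sub_smul, ← add_sub_assoc, k4, hd, mul_smul]; abel
    have hPx : perpProj v x = x := by
      conv_rhs => rw [eq_dot_smul_add_perpProj hv x, hx, zero_smul, zero_add]
    have hPC : perpProj v c + τ • perpProj v (e₁ - e₂) + ζ • perpProj v e₃ = x := by
      rw [← hproj, hC, perpProj_add, perpProj_smul, perpProj_self, smul_zero, add_zero, hPx]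
    rw [h.chord_eq hL hd k1 k2 k3 hC, hausdorffMeasure_segment hv] at hr
    have hτ : |τ| ≤ 1 / 2 := by linarith [abs_nonneg s]
    rw [hlen _ _ (by nlinarith)] at hr
    have key := mem_zonogon_of_chordPos (c := perpProj v c) (e₁ := symmEdge₁ v e₁ e₂)
      (e₂ := symmEdge₂ v e₁ e₂) (e₃ := perpProj v e₃) (s := r / L) (τ := τ) (ζ := ζ) (by
        rw [abs_div, abs_of_pos hL]
        have : |r| / L ≤ 1 / 2 - |τ| := by rw [div_le_iff₀ hL]; linarith
        linarith) k2
    convert key using 1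
    rw [symmEdge_add, symmEdge_sub, hd, smul_smul, div_mul_cancel₀ _ hL.ne', ← hPC]; abel
  · intro hy
    obtain ⟨s, τ, ζ, k1, k2, k3, rfl⟩ := exists_chordPos (h.symm hv hd).1 hy
    rw [(symmEdge_cross (e₃ := e₃) hv hd).1] at k3
    rw [symmEdge_add, symmEdge_sub]
    set C := c + τ • (e₁ - e₂) + ζ • e₃ with hCdef
    have hC : C = perpProj v C + dot C v • v := by
      rw [add_comm]; exact eq_dot_smul_add_perpProj hv C
    have hτ : |τ| ≤ 1 / 2 := by linarith [abs_nonneg s]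
    refine ⟨perpProj v C, s * L, by rw [inner_eq_dot, dot_perpProj], ⟨C, ⟨_, hC⟩, ?_⟩, ?_, ?_⟩
    · have key := mem_zonogon_of_chordPos (c := c) (e₁ := e₁) (e₂ := e₂) (e₃ := e₃) (s := 0)
        (τ := τ) (ζ := ζ) (by simpa using hτ) k2
      rwa [zero_smul, add_zero] at key
    · rw [h.chord_eq hL hd k1 k2 k3 hC, hausdorffMeasure_segment hv, hlen _ _ (by nlinarith),
        abs_mul, abs_of_pos hL]
      nlinarith
    · rw [hproj, hd, mul_smul]; abel

/-- The sum of the squared lengths of the centre and of the edge vectors. -/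
noncomputable def energy (c e₁ e₂ e₃ : Plane) : ℝ :=
  dot c c + dot e₁ e₁ + dot e₂ e₂ + dot e₃ e₃

/-- By the parallelogram law the first two edges contribute half the squares of their sum and
difference. The sum is kept, and each projected vector loses the square of its component along `v`.
-/
theorem energy_symm {v : Plane} (hv : ‖v‖ = 1) (c e₁ e₂ e₃ : Plane) :
    energy (perpProj v c) (symmEdge₁ v e₁ e₂) (symmEdge₂ v e₁ e₂) (perpProj v e₃) =
      energy c e₁ e₂ e₃ - dot c v ^ 2 - dot (e₁ - e₂) v ^ 2 / 2 - dot e₃ v ^ 2 := by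
  have h1 : dot (symmEdge₁ v e₁ e₂) (symmEdge₁ v e₁ e₂) +
      dot (symmEdge₂ v e₁ e₂) (symmEdge₂ v e₁ e₂) =
      (dot (e₁ + e₂) (e₁ + e₂) + dot (perpProj v (e₁ - e₂)) (perpProj v (e₁ - e₂))) / 2 := by
    simp only [symmEdge₁, symmEdge₂, dot, PiLp.add_apply, PiLp.sub_apply, PiLp.smul_apply,
      smul_eq_mul]
    ring
  have h2 : dot (e₁ + e₂) (e₁ + e₂) + dot (e₁ - e₂) (e₁ - e₂) = 2 * (dot e₁ e₁ + dot e₂ e₂) := by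
    simp only [dot, PiLp.add_apply, PiLp.sub_apply]; ring
  rw [dot_perpProj_self hv] at h1
  unfold energy
  rw [dot_perpProj_self hv, dot_perpProj_self hv]
  linarith

/-! ### Convex tiles: faces and translations -/

/-- `T` is a set of translations by which the convex body `H` tiles the plane. -/
structure IsTiling (H T : Set Plane) : Prop where
  convex : Convex ℝ H
  isCompact : IsCompact H
  interior_nonempty : (interior H).Nonempty
  covers : ∀ y, ∃ t ∈ T, y - t ∈ H
  disjoint : ∀ s ∈ T, ∀ t ∈ T, s ≠ t → ∀ x, x - s ∈ interior H → x - t ∉ H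

theorem IsTiling.of_tessellates {H T : Set Plane} (hH : IsConvexPolygon H)
    (hcov : (⋃ t ∈ T, (fun x => t + x) '' H) = Set.univ)
    (hdis : T.PairwiseDisjoint fun t => interior ((fun x => t + x) '' H)) : IsTiling H T := by
  obtain ⟨⟨s, rfl⟩, hint⟩ := hH
  refine ⟨convex_convexHull _ _, s.finite_toSet.isCompact_convexHull ℝ, hint, fun y => ?_,
    fun a ha b hb hab x hx hxb => ?_⟩
  · have : y ∈ ⋃ t ∈ T, (fun x => t + x) '' convexHull ℝ (s : Set Plane) := by
      rw [hcov]; trivial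
    obtain ⟨t, ht, hy⟩ := Set.mem_iUnion₂.1 this
    exact ⟨t, ht, translate_mem_iff.1 hy⟩
  -- A convex body is the closure of its interior, so disjoint interiors already prevent the
  -- interior of one tile from meeting another tile.
  · have hcl : x - b ∈ closure (interior (convexHull ℝ (s : Set Plane))) := by
      rw [(convex_convexHull _ _).closure_interior_eq_closure_of_nonempty_interior hint]
      exact subset_closure hxb
    have hopen : IsOpen {z : Plane | z + b - a ∈ interior (convexHull ℝ (s : Set Plane))} :=
      isOpen_interior.preimage (by fun_prop)
    obtain ⟨z, hz, hz'⟩ := mem_closure_iff.1 hcl _ hopen (by simpa using hx)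
    have h1 : z + b ∈ interior ((fun x => a + x) '' convexHull ℝ (s : Set Plane)) := by
      rw [interior_translate, translate_mem_iff]; exact hz
    have h2 : z + b ∈ interior ((fun x => b + x) '' convexHull ℝ (s : Set Plane)) := by
      rw [interior_translate, translate_mem_iff, add_sub_cancel_right]; exact hz'
    exact Set.disjoint_left.1 (hdis ha hb hab) h1 h2

theorem add_zsmul_mem_of_invariant {T : Set Plane} {τ t : Plane} (h1 : ∀ t ∈ T, t + τ ∈ T) (h2 : ∀ t ∈ T, t - τ ∈ T)
    (ht : t ∈ T) (n : ℤ) : t + (n : ℝ) • τ ∈ T := by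
  induction n using Int.induction_on with
  | zero => simpa using ht
  | succ n ih =>
    have := h1 _ ih
    convert this using 1
    push_cast; module
  | pred n ih =>
    have := h2 _ ih
    convert this using 1
    push_cast; module

namespace IsTiling

variable {H T : Set Plane} (hT : IsTiling H T)
include hT

theorem exists_separation : ∃ δ : ℝ, 0 < δ ∧ ∀ s ∈ T, ∀ t ∈ T, dist s t < δ → s = t := by
  obtain ⟨o, ho⟩ := hT.interior_nonempty
  obtain ⟨δ, δ0, hδ⟩ := Metric.isOpen_iff.1 isOpen_interior o ho
  refine ⟨δ, δ0, fun s hs t ht hst => ?_⟩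
  by_contra hne
  refine hT.disjoint s hs t ht hne (o + s) (by simpa using ho) (interior_subset (hδ ?_))
  rw [Metric.mem_ball, dist_eq_norm, show o + s - t - o = s - t by abel, ← dist_eq_norm]
  exact hst

/-- A point of a tile that is not interior to it belongs to another tile. -/
theorem exists_other {t y : Plane} (hy : y - t ∉ interior H) : ∃ s ∈ T, s ≠ t ∧ y - s ∈ H := by
  have hcl : y ∈ closure {z | z - t ∉ H} := by
    rw [mem_closure_iff_nhds]
    intro U hU
    by_contra hemp
    apply hy
    rw [mem_interior_iff_mem_nhds]
    have hc : Filter.Tendsto (fun z : Plane => z + t) (nhds (y - t)) (nhds y) := by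
      have : Continuous fun z : Plane => z + t := by fun_prop
      simpa using this.tendsto (y - t)
    filter_upwards [hc hU] with z hz
    by_contra hzH
    exact hemp ⟨z + t, hz, by simpa using hzH⟩
  obtain ⟨u, hu, hlim⟩ := mem_closure_iff_seq_limit.1 hcl
  choose s hs hsH using fun n => hT.covers (u n)
  obtain ⟨p, hp, φ, hφ, hpl⟩ := hT.isCompact.tendsto_subseq hsH
  have hsl : Filter.Tendsto (fun n => s (φ n)) Filter.atTop (nhds (y - p)) := by
    have := (hlim.comp hφ.tendsto_atTop).sub hpl
    refine this.congr fun n => ?_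
    simp
  -- The translations of the tiles covering the points `u n` converge along a subsequence. Being
  -- uniformly separated, they are eventually constant.
  obtain ⟨δ, δ0, hδ⟩ := hT.exists_separation
  obtain ⟨N, hN⟩ := Metric.cauchySeq_iff'.1 hsl.cauchySeq δ δ0
  have hconst : ∀ n ≥ N, s (φ n) = s (φ N) := fun n hn => hδ _ (hs _) _ (hs _) (hN n hn)
  have hyp : y - p = s (φ N) := by
    refine tendsto_nhds_unique hsl (tendsto_const_nhds.congr' ?_)
    filter_upwards [Filter.eventually_ge_atTop N] with n hn
    exact (hconst n hn).symm
  refine ⟨s (φ N), hs _, fun h => ?_, by rw [← hyp]; simpa using hp⟩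
  apply hu (φ N)
  rw [← h]
  exact hsH _

/-- Translations of the tiling parallel to a chord are at least as long as the chord. -/
theorem translation_chord {w x s : Plane} {L r : ℝ} (hw : w ≠ 0) (hx : x ∈ H)
    (hx' : x + L • w ∈ H) (hr : 0 < r) (hrL : r < L) (hs : s ∈ T) : s + r • w ∉ T := by
  intro hs'
  obtain ⟨o, ho⟩ := hT.interior_nonempty
  have hL : 0 < L := hr.trans hrL
  have h1 : r / L < 1 := by rwa [div_lt_one hL]
  have h0 : 0 ≤ r / L := by positivity
  -- Contracting towards the interior point `o` with ratio `r / L` carries the chord to an interior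
  -- chord equal to `r • w`. Its endpoints would make the two tiles overlap.
  have hp := hT.convex.combo_interior_self_mem_interior ho hx (sub_pos.2 h1) h0 (by ring)
  have hq := hT.convex.combo_interior_self_mem_interior ho hx' (sub_pos.2 h1) h0 (by ring)
  refine hT.disjoint s hs _ hs' ?_ (s + ((1 - r / L) • o + (r / L) • (x + L • w))) (by simpa using hq) ?_
  · intro h
    have : r • w = 0 := by simpa using h.symm
    rcases smul_eq_zero.1 this with h | h
    · exact hr.ne' h
    · exact hw h
  · convert interior_subset hp using 1
    have e : r • w = (r / L) • L • w := by rw [smul_smul, div_mul_cancel₀ _ hL.ne']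
    rw [e]
    module

end IsTiling

/-- The face of `H` on which `cross w` is maximal is the segment from `A` to `A + ℓ • w`. -/
def IsMaxFace (H : Set Plane) (w A : Plane) (ℓ : ℝ) : Prop :=
  0 ≤ ℓ ∧ ∀ x, (x ∈ H ∧ ∀ y ∈ H, cross w y ≤ cross w x) ↔ ∃ r, 0 ≤ r ∧ r ≤ ℓ ∧ x = A + r • w

/-- The face of `H` on which `cross w` is minimal is the segment from `C` to `C + ℓ • w`. -/
def IsMinFace (H : Set Plane) (w C : Plane) (ℓ : ℝ) : Prop :=
  0 ≤ ℓ ∧ ∀ x, (x ∈ H ∧ ∀ y ∈ H, cross w x ≤ cross w y) ↔ ∃ r, 0 ≤ r ∧ r ≤ ℓ ∧ x = C + r • w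

theorem isMaxFace_neg {H : Set Plane} {w C : Plane} {ℓ : ℝ} (h : IsMinFace H w C ℓ) :
    IsMaxFace H (-w) (C + ℓ • w) ℓ := by
  refine ⟨h.1, fun x => ?_⟩
  simp only [cross_neg_left, neg_le_neg_iff]
  rw [h.2 x]
  constructor
  · rintro ⟨r, h0, h1, rfl⟩
    exact ⟨ℓ - r, by linarith, by linarith, by module⟩
  · rintro ⟨r, h0, h1, rfl⟩
    exact ⟨ℓ - r, by linarith, by linarith, by module⟩

theorem isMinFace_neg {H : Set Plane} {w A : Plane} {ℓ : ℝ} (h : IsMaxFace H w A ℓ) :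
    IsMinFace H (-w) (A + ℓ • w) ℓ := by
  refine ⟨h.1, fun x => ?_⟩
  simp only [cross_neg_left, neg_le_neg_iff]
  rw [h.2 x]
  constructor
  · rintro ⟨r, h0, h1, rfl⟩
    exact ⟨ℓ - r, by linarith, by linarith, by module⟩
  · rintro ⟨r, h0, h1, rfl⟩
    exact ⟨ℓ - r, by linarith, by linarith, by module⟩

/-! ### Existence and elementary properties of faces -/

theorem dot_add_smul (w x : Plane) (r : ℝ) : dot w (x + r • w) = dot w x + r * dot w w := by
  simp only [dot, PiLp.add_apply, PiLp.smul_apply, smul_eq_mul]; ring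

theorem continuous_dot (u : Plane) : Continuous (dot u) := by
  unfold dot; fun_prop

theorem exists_isMaxFace {H : Set Plane} (hc : IsCompact H) (hconv : Convex ℝ H)
    (hne : H.Nonempty) {w : Plane} (hw : w ≠ 0) : ∃ A ℓ, IsMaxFace H w A ℓ := by
  obtain ⟨m, hm, hmax⟩ := hc.exists_isMaxOn hne (continuous_cross w).continuousOn
  set F : Set Plane := H ∩ {x | cross w x = cross w m} with hF
  have hFc : IsCompact F := hc.inter_right (isClosed_eq (continuous_cross w) continuous_const)
  obtain ⟨A, hA, hAmin⟩ := hFc.exists_isMinOn ⟨m, hm, rfl⟩ (continuous_dot w).continuousOn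
  obtain ⟨B, hB, hBmax⟩ := hFc.exists_isMaxOn ⟨m, hm, rfl⟩ (continuous_dot w).continuousOn
  have hp := dot_self_pos hw
  have hpar : ∀ x ∈ F, ∃ r : ℝ, x = A + r • w := by
    intro x hx
    obtain ⟨r, hr⟩ := eq_smul_of_cross_eq_zero hw (x := x - A) (by
      rw [cross_sub_right, hx.2, hA.2, sub_self])
    exact ⟨r, by rw [← hr]; abel⟩
  obtain ⟨ℓ, rfl⟩ := hpar B hB
  have hmono : ∀ r r' : ℝ, dot w (A + r • w) ≤ dot w (A + r' • w) → r ≤ r' := by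
    intro r r' h
    rw [dot_add_smul, dot_add_smul] at h
    nlinarith
  have hℓ : 0 ≤ ℓ := hmono 0 ℓ (by rw [zero_smul, add_zero]; exact hAmin hB)
  refine ⟨A, ℓ, hℓ, fun x => ⟨?_, ?_⟩⟩
  · rintro ⟨hx, hxmax⟩
    have hxF : x ∈ F := ⟨hx, le_antisymm (hmax hx) (hxmax m hm)⟩
    obtain ⟨r, rfl⟩ := hpar x hxF
    exact ⟨r, hmono 0 r (by rw [zero_smul, add_zero]; exact hAmin hxF), hmono r ℓ (hBmax hxF), rfl⟩
  · rintro ⟨r, h0, h1, rfl⟩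
    refine ⟨?_, fun y hy => ?_⟩
    · rcases hℓ.eq_or_lt with h | h
      · obtain rfl : r = 0 := by linarith
        simpa using hA.1
      · have := hconv hA.1 hB.1 (a := 1 - r / ℓ) (b := r / ℓ)
          (by rw [sub_nonneg]; exact div_le_one_of_le₀ h1 hℓ) (by positivity) (by ring)
        convert this using 1
        have e : r / ℓ * ℓ = r := by field_simp
        conv_lhs => rw [← e]
        module
    · rw [cross_add_right, cross_smul_right, cross_same, mul_zero, add_zero, hA.2]
      exact hmax hy

theorem exists_isMinFace {H : Set Plane} (hc : IsCompact H) (hconv : Convex ℝ H)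
    (hne : H.Nonempty) {w : Plane} (hw : w ≠ 0) : ∃ C ℓ, IsMinFace H w C ℓ := by
  obtain ⟨A, ℓ, h⟩ := exists_isMaxFace hc hconv hne (neg_ne_zero.2 hw)
  exact ⟨_, ℓ, by simpa using isMinFace_neg h⟩

theorem IsMaxFace.mem {H : Set Plane} {w A : Plane} {ℓ r : ℝ} (h : IsMaxFace H w A ℓ)
    (h0 : 0 ≤ r) (h1 : r ≤ ℓ) : A + r • w ∈ H := ((h.2 _).2 ⟨r, h0, h1, rfl⟩).1

theorem IsMinFace.mem {H : Set Plane} {w C : Plane} {ℓ r : ℝ} (h : IsMinFace H w C ℓ)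
    (h0 : 0 ≤ r) (h1 : r ≤ ℓ) : C + r • w ∈ H := ((h.2 _).2 ⟨r, h0, h1, rfl⟩).1

theorem IsMaxFace.le {H : Set Plane} {w A y : Plane} {ℓ : ℝ} (h : IsMaxFace H w A ℓ)
    (hy : y ∈ H) : cross w y ≤ cross w A :=
  ((h.2 A).2 ⟨0, le_rfl, h.1, by simp⟩).2 y hy

theorem IsMinFace.le {H : Set Plane} {w C y : Plane} {ℓ : ℝ} (h : IsMinFace H w C ℓ)
    (hy : y ∈ H) : cross w C ≤ cross w y :=
  ((h.2 C).2 ⟨0, le_rfl, h.1, by simp⟩).2 y hy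

theorem IsMaxFace.lt_of_mem_interior {H : Set Plane} {w A y : Plane} {ℓ : ℝ} (hw : w ≠ 0)
    (h : IsMaxFace H w A ℓ) (hy : y ∈ interior H) : cross w y < cross w A := by
  have hcont : Continuous fun ε : ℝ => y + ε • rot w := by fun_prop
  have hev : ∀ᶠ ε : ℝ in nhds 0, y + ε • rot w ∈ H := by
    have : H ∈ nhds (y + (0 : ℝ) • rot w) := by simpa using mem_interior_iff_mem_nhds.1 hy
    exact hcont.continuousAt this
  obtain ⟨δ, δ0, hδ⟩ := Metric.eventually_nhds_iff.1 hev
  have a := h.le (hδ (y := δ / 2) (by simp [abs_of_pos δ0]; linarith))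
  rw [cross_add_right, cross_smul_right, cross_rot_self] at a
  have := dot_self_pos hw
  nlinarith

theorem IsMinFace.lt_of_mem_interior {H : Set Plane} {w C y : Plane} {ℓ : ℝ} (hw : w ≠ 0)
    (h : IsMinFace H w C ℓ) (hy : y ∈ interior H) : cross w C < cross w y := by
  have := (isMaxFace_neg h).lt_of_mem_interior (neg_ne_zero.2 hw) hy
  simpa [cross_same] using this

/-- At a relative interior point of a maximal face, a convex set contains a half disk. -/
theorem IsMaxFace.exists_mem {H : Set Plane} {w A u : Plane} {ℓ r : ℝ} (hconv : Convex ℝ H)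
    (hint : (interior H).Nonempty) (hw : w ≠ 0) (h : IsMaxFace H w A ℓ) (h0 : 0 < r) (h1 : r < ℓ)
    (hu : cross w u < 0) : ∃ ε : ℝ, 0 < ε ∧ ε < 1 ∧ A + r • w + ε • u ∈ H := by
  obtain ⟨o, ho⟩ := hint
  have ho' := h.lt_of_mem_interior hw ho
  have hneg : cross w (o - A - r • w) < 0 := by
    rw [cross_sub_right, cross_sub_right, cross_smul_right, cross_same]; linarith
  set b := cross w u / cross w (o - A - r • w) with hb
  have b0 : 0 < b := div_pos_of_neg_of_neg hu hneg
  obtain ⟨a, ha⟩ := eq_smul_of_cross_eq_zero hw (x := u - b • (o - A - r • w)) (by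
    rw [cross_sub_right w u, cross_smul_right, hb, div_mul_cancel₀ _ hneg.ne, sub_self])
  -- The point sought is a convex combination of `o`, with weight `ε * b`, and the point `A + f ε •
  -- w`. The latter stays on the face for small `ε` because `f 0 = r` lies strictly inside.
  set f : ℝ → ℝ := fun ε => (r + ε * (a - b * r)) / (1 - ε * b) with hf
  have hfc : ContinuousAt f 0 := by
    apply ContinuousAt.div
    · fun_prop
    · fun_prop
    · norm_num
  have hf0 : f 0 = r := by simp [hf]
  have e1 : ∀ᶠ ε in nhds (0 : ℝ), 0 < f ε := hfc.eventually_const_lt (by rwa [hf0])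
  have e2 : ∀ᶠ ε in nhds (0 : ℝ), f ε < ℓ := hfc.eventually_lt_const (by rwa [hf0])
  have e3 : ∀ᶠ ε in nhds (0 : ℝ), ε * b < 1 :=
    (show ContinuousAt (fun ε : ℝ => ε * b) 0 by fun_prop).eventually_lt_const (by simp)
  have e4 : ∀ᶠ ε in nhds (0 : ℝ), ε < 1 := eventually_lt_nhds one_pos
  obtain ⟨ε, ⟨⟨⟨k1, k2⟩, k3⟩, k4⟩, k5⟩ :=
    (((((e1.and e2).and e3).and e4).filter_mono nhdsWithin_le_nhds).and
      (self_mem_nhdsWithin (s := Set.Ioi (0 : ℝ)))).exists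
  have k5 : 0 < ε := k5
  refine ⟨ε, k5, k4, ?_⟩
  have key := hconv (h.mem k1.le k2.le) (interior_subset ho) (a := 1 - ε * b) (b := ε * b)
    (by linarith) (by positivity) (by ring)
  convert key using 1
  have hfe : (1 - ε * b) * f ε = r + ε * (a - b * r) := by
    rw [hf]; field_simp [show 1 - ε * b ≠ 0 by linarith]
  have hu' : u = a • w + b • (o - A - r • w) := by rw [← ha]; abel
  rw [smul_add, smul_smul, hfe, hu']
  module

namespace IsTiling

variable {H T : Set Plane} (hT : IsTiling H T)
include hT

/-- The relative interior of an edge is covered by the opposite edges of other tiles. -/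
theorem exists_opposite {w A C t : Plane} {ℓ ℓ' r : ℝ} (hw : w ≠ 0) (hA : IsMaxFace H w A ℓ)
    (hC : IsMinFace H w C ℓ') (ht : t ∈ T) (h0 : 0 < r) (h1 : r < ℓ) :
    ∃ a : ℝ, a ≤ r ∧ r ≤ a + ℓ' ∧ t + (A - C) + a • w ∈ T := by
  obtain ⟨s, hs, hst, hsH⟩ := hT.exists_other (t := t) (y := t + (A + r • w)) (by
    intro hmem
    have := hA.lt_of_mem_interior hw hmem
    rw [add_sub_cancel_left, cross_add_right, cross_smul_right, cross_same] at this
    linarith)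
  set p := t + (A + r • w) - s with hp
  -- If `p` were not on the minimal face, an interior point `z` would lie below it. Moving slightly
  -- in the direction `z - p` enters the interior of the tile at `s` while remaining in the tile at
  -- `t`.
  have hmin : ∀ y ∈ H, cross w p ≤ cross w y := by
    by_contra hcon
    push Not at hcon
    obtain ⟨y, hy, hlt⟩ := hcon
    have hcl : y ∈ closure (interior H) := by
      rw [hT.convex.closure_interior_eq_closure_of_nonempty_interior hT.interior_nonempty]
      exact subset_closure hy
    obtain ⟨z, hz, hzi⟩ := mem_closure_iff.1 hcl {z | cross w z < cross w p}
      (isOpen_lt (continuous_cross w) continuous_const) hlt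
    obtain ⟨ε, ε0, ε1, hε⟩ := hA.exists_mem hT.convex hT.interior_nonempty hw h0 h1 (u := z - p) (by
      rw [cross_sub_right]; exact sub_neg.2 hz)
    have hin := hT.convex.combo_interior_self_mem_interior hzi hsH ε0 (sub_nonneg.2 ε1.le)
      (by ring)
    refine hT.disjoint s hs t ht hst (t + (A + r • w + ε • (z - p))) ?_ (by simpa using hε)
    convert hin using 1
    rw [show t + (A + r • w + ε • (z - p)) - s = p + ε • (z - p) by rw [hp]; abel]
    module
  obtain ⟨ρ, ρ0, ρ1, hρ⟩ := (hC.2 p).1 ⟨hsH, hmin⟩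
  refine ⟨r - ρ, by linarith, by linarith, ?_⟩
  convert hs using 1
  have : s = t + (A + r • w) - p := by rw [hp]; abel
  rw [this, hρ]; module

theorem abs_sub_ge {w x s : Plane} {L a a' : ℝ} (hw : w ≠ 0) (hx : x ∈ H) (hx' : x + L • w ∈ H)
    (ha : s + a • w ∈ T) (ha' : s + a' • w ∈ T) (hlt : a < a') : L ≤ a' - a := by
  by_contra hcon
  refine hT.translation_chord hw hx hx' (sub_pos.2 hlt) (not_le.1 hcon) ha ?_
  convert ha' using 1
  module

/-- If a touching tile stopped before the end of the edge, the next one would have to start within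
little more than `ℓ'` of it. The chord of length `L > ℓ'` keeps the two tiles farther apart. -/
theorem touching_ge {w A C t x : Plane} {ℓ ℓ' L r a : ℝ} (hw : w ≠ 0) (hA : IsMaxFace H w A ℓ)
    (hC : IsMinFace H w C ℓ') (ht : t ∈ T) (hx : x ∈ H) (hx' : x + L • w ∈ H) (hL : ℓ' < L)
    (h0 : 0 < r) (hra : r ≤ a + ℓ') (ha : t + (A - C) + a • w ∈ T) : ℓ ≤ a + ℓ' := by
  by_contra hcon
  push Not at hcon
  set η := min (ℓ - (a + ℓ')) (L - ℓ') / 2 with hη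
  have hmin : 0 < min (ℓ - (a + ℓ')) (L - ℓ') := lt_min (by linarith) (by linarith)
  have m1 := min_le_left (ℓ - (a + ℓ')) (L - ℓ')
  have m2 := min_le_right (ℓ - (a + ℓ')) (L - ℓ')
  have η0 : 0 < η := by positivity
  obtain ⟨a', k1, k2, k3⟩ := hT.exists_opposite hw hA hC ht (r := a + ℓ' + η) (by linarith)
    (by linarith)
  have := hT.abs_sub_ge hw hx hx' ha k3 (by linarith)
  linarith

/-- If `ℓ' < ℓ`, the longer edge is itself a chord exceeding the shorter one, so a tile touching
near the start would have to reach the end of the edge. -/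
theorem length_le {w A C : Plane} {ℓ ℓ' : ℝ} (hw : w ≠ 0) (hA : IsMaxFace H w A ℓ)
    (hC : IsMinFace H w C ℓ') : ℓ ≤ ℓ' := by
  by_contra hcon
  push Not at hcon
  obtain ⟨t, ht, -⟩ := hT.covers 0
  have h0 : 0 ≤ ℓ' := hC.1
  have hA0 : A ∈ H := by simpa using hA.mem le_rfl hA.1
  obtain ⟨a, k1, k2, k3⟩ := hT.exists_opposite hw hA hC ht (r := (ℓ - ℓ') / 2) (by linarith)
    (by linarith)
  have := hT.touching_ge hw hA hC ht hA0 (hA.mem hA.1 le_rfl) hcon (r := (ℓ - ℓ') / 2)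
    (by linarith) k2 k3
  linarith

/-- Opposite faces of a tile have the same length. -/
theorem length_eq {w A C : Plane} {ℓ ℓ' : ℝ} (hw : w ≠ 0) (hA : IsMaxFace H w A ℓ)
    (hC : IsMinFace H w C ℓ') : ℓ' = ℓ :=
  le_antisymm (hT.length_le (neg_ne_zero.2 hw) (isMaxFace_neg hC) (isMinFace_neg hA))
    (hT.length_le hw hA hC)

/-- If some chord is longer than an edge parallel to it, then the tiling is invariant under the
translation taking the opposite edge to that edge. -/
theorem translation_mem {w A C t x : Plane} {ℓ L : ℝ} (hw : w ≠ 0) (hA : IsMaxFace H w A ℓ)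
    (hC : IsMinFace H w C ℓ) (hℓ : 0 < ℓ) (hx : x ∈ H) (hx' : x + L • w ∈ H) (hL : ℓ < L)
    (ht : t ∈ T) : t + (A - C) ∈ T := by
  obtain ⟨a, k1, k2, k3⟩ := hT.exists_opposite hw hA hC ht (r := ℓ / 2) (by linarith) (by linarith)
  have ha := hT.touching_ge hw hA hC ht hx hx' hL (by linarith) k2 k3
  have ha0 : 0 ≤ a := by linarith
  rcases ha0.eq_or_lt with rfl | ha0
  · simpa using k3
  -- If `a > 0`, the initial piece of the edge needs another tile with offset `b` between `0` and `a
  -- / 2`. Then `a - b ≤ ℓ / 2`, whereas the long chord demands at least `L > ℓ`.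
  obtain ⟨b, l1, l2, l3⟩ := hT.exists_opposite hw hA hC ht (r := a / 2) (by linarith) (by linarith)
  have hb := hT.touching_ge hw hA hC ht hx hx' hL (by linarith) l2 l3
  have := hT.abs_sub_ge hw hx hx' l3 k3 (by linarith)
  linarith

theorem translation_mem_neg {w A C t x : Plane} {ℓ L : ℝ} (hw : w ≠ 0) (hA : IsMaxFace H w A ℓ)
    (hC : IsMinFace H w C ℓ) (hℓ : 0 < ℓ) (hx : x ∈ H) (hx' : x + L • w ∈ H) (hL : ℓ < L)
    (ht : t ∈ T) : t - (A - C) ∈ T := by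
  have := hT.translation_mem (neg_ne_zero.2 hw) (isMaxFace_neg hC) (isMinFace_neg hA) hℓ hx'
    (L := L) (by simpa using hx) hL ht
  convert this using 1
  abel

/-- A tile without chords longer than a parallel edge is a parallelogram. -/
theorem eq_parallelogram {w A C : Plane} {ℓ : ℝ} (hw : w ≠ 0) (hA : IsMaxFace H w A ℓ)
    (hC : IsMinFace H w C ℓ) (hℓ : 0 < ℓ)
    (hch : ∀ x L, x ∈ H → x + L • w ∈ H → L ≤ ℓ) :
    ∃ c e₁ e₂ e₃, Ordered e₁ e₂ e₃ ∧ H = zonogon c e₁ e₂ e₃ := by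
  obtain ⟨o, ho⟩ := hT.interior_nonempty
  have hlt : 0 < cross w (A - C) := by
    rw [cross_sub_right]
    linarith [hA.lt_of_mem_interior hw ho, hC.lt_of_mem_interior hw ho]
  have hpar : ∀ α β : ℝ, 0 ≤ α → α ≤ ℓ → 0 ≤ β → β ≤ 1 → C + α • w + β • (A - C) ∈ H := by
    intro α β a0 a1 b0 b1
    have := hT.convex (hC.mem a0 a1) (hA.mem a0 a1) (sub_nonneg.2 b1) b0 (by ring)
    convert this using 1
    module
  refine ⟨C + (ℓ / 2) • w + (1 / 2 : ℝ) • (A - C), ℓ • w, A - C, 0, ⟨?_, ?_, ?_, ?_⟩, ?_⟩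
  · rw [cross_smul_left]; positivity
  · simp
  · simp
  · rw [crossSum, cross_zero_right, cross_zero_right, add_zero, add_zero, cross_smul_left]
    positivity
  · ext y
    constructor
    · intro hy
      set β := cross w (y - C) / cross w (A - C) with hβ
      have hβ1 : β * cross w (A - C) = cross w (y - C) := by rw [hβ]; field_simp
      obtain ⟨α, hα⟩ := eq_smul_of_cross_eq_zero hw (x := y - C - β • (A - C)) (by
        rw [cross_sub_right, cross_smul_right, hβ1, sub_self])
      have hy' : y = C + α • w + β • (A - C) := by rw [← hα]; abel
      have b0 : 0 ≤ β := div_nonneg (by rw [cross_sub_right]; linarith [hC.le hy]) hlt.le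
      have b1 : β ≤ 1 := div_le_one_of_le₀ (by
        rw [cross_sub_right, cross_sub_right]; linarith [hA.le hy]) hlt.le
      -- At height `β` the parallelogram has a chord of length `ℓ`. A point outside it would extend
      -- that chord beyond `ℓ`, on one side or the other.
      have a1 : α ≤ ℓ := by
        have := hch (C + (0 : ℝ) • w + β • (A - C)) α (hpar 0 β le_rfl hℓ.le b0 b1) (by
          convert hy using 1; rw [hy']; module)
        exact this
      have a0 : 0 ≤ α := by
        have := hch y (ℓ - α) hy (by
          convert hpar ℓ β hℓ.le le_rfl b0 b1 using 1; rw [hy']; module)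
        linarith
      have e : α / ℓ * ℓ = α := by field_simp
      refine ⟨α / ℓ - 1 / 2, β - 1 / 2, 0, abs_le.2 ⟨?_, ?_⟩, abs_le.2 ⟨?_, ?_⟩, by norm_num, ?_⟩
      · have : 0 ≤ α / ℓ := by positivity
        linarith
      · have : α / ℓ ≤ 1 := div_le_one_of_le₀ a1 hℓ.le
        linarith
      · linarith
      · linarith
      · rw [hy']
        conv_lhs => rw [← e]
        module
    · rintro ⟨x₁, x₂, x₃, h1, h2, -, rfl⟩
      rw [abs_le] at h1 h2
      have := hpar ((x₁ + 1 / 2) * ℓ) (x₂ + 1 / 2) (by nlinarith) (by nlinarith) (by linarith)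
        (by linarith)
      convert this using 1
      module

end IsTiling

/-! ### Classification of the convex polygons which tile by translations -/

theorem Convex.three_mem {K : Set Plane} (hK : Convex ℝ K) {x y z : Plane} {a b c : ℝ}
    (hx : x ∈ K) (hy : y ∈ K) (hz : z ∈ K) (ha : 0 ≤ a) (hb : 0 ≤ b) (hc : 0 ≤ c)
    (h : a + b + c = 1) : a • x + b • y + c • z ∈ K := by
  have := hK.sum_mem (t := Finset.univ) (w := ![a, b, c]) (z := ![x, y, z])
    (by intro i _; fin_cases i <;> simpa) (by simp [Fin.sum_univ_three, h])
    (by intro i _; fin_cases i <;> simpa)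
  simpa [Fin.sum_univ_three] using this

theorem Convex.four_mem {K : Set Plane} (hK : Convex ℝ K) {c d e : Plane} {s ζ : ℝ}
    (hs : |s| ≤ 1 / 2) (hζ : |ζ| ≤ 1 / 2)
    (h1 : c + (1 / 2 : ℝ) • d + (1 / 2 : ℝ) • e ∈ K) (h2 : c + (-1 / 2 : ℝ) • d + (1 / 2 : ℝ) • e ∈ K)
    (h3 : c + (1 / 2 : ℝ) • d + (-1 / 2 : ℝ) • e ∈ K)
    (h4 : c + (-1 / 2 : ℝ) • d + (-1 / 2 : ℝ) • e ∈ K) : c + s • d + ζ • e ∈ K := by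
  refine smul_add_mem_of_convex hK hζ ?_ ?_ <;> rw [add_right_comm] <;>
    refine smul_add_mem_of_convex hK hs ?_ ?_ <;> rw [add_right_comm] <;> assumption

/-- A convex set contains a zonogon as soon as it contains its six vertices. -/
theorem Ordered.zonogon_subset {K : Set Plane} (hK : Convex ℝ K) {P e₁ e₂ e₃ : Plane}
    (h : Ordered e₁ e₂ e₃) (h0 : P ∈ K) (h1 : P + e₁ ∈ K) (h2 : P + (e₁ + e₂) ∈ K)
    (h3 : P + (e₁ + e₂ + e₃) ∈ K) (h4 : P + (e₂ + e₃) ∈ K) (h5 : P + e₃ ∈ K) :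
    zonogon (P + (1 / 2 : ℝ) • (e₁ + e₂ + e₃)) e₁ e₂ e₃ ⊆ K := by
  intro y hy
  obtain ⟨s, τ, ζ, k1, k2, -, rfl⟩ := exists_chordPos h hy
  rcases k2 with ⟨rfl, k2⟩ | ⟨k2, rfl⟩ | ⟨k2, rfl⟩
  · rw [abs_zero, add_zero] at k1
    rw [zero_smul, add_zero]
    refine hK.four_mem k1 k2 ?_ ?_ ?_ ?_
    · convert h3 using 1; module
    · convert h5 using 1; module
    · convert h2 using 1; module
    · convert h0 using 1; module
  · rw [abs_of_nonpos k2] at k1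
    have ks := abs_le.1 (show |s| ≤ 1 / 2 + τ by linarith)
    have := hK.three_mem h4 h3 h5 (a := -2 * τ) (b := 1 / 2 + τ + s) (c := 1 / 2 + τ - s)
      (by linarith) (by linarith) (by linarith) (by ring)
    convert this using 1
    module
  · rw [abs_of_nonneg k2] at k1
    have ks := abs_le.1 (show |s| ≤ 1 / 2 - τ by linarith)
    have := hK.three_mem h1 h2 h0 (a := 2 * τ) (b := 1 / 2 - τ + s) (c := 1 / 2 - τ - s)
      (by linarith) (by linarith) (by linarith) (by ring)
    convert this using 1
    module

theorem cross_le_of_hull {s : Set Plane} {w : Plane} {B : ℝ} (h : ∀ x ∈ s, cross w x ≤ B) {x : Plane}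
    (hx : x ∈ convexHull ℝ s) : cross w x ≤ B := by
  refine convexHull_min (t := {x | cross w x ≤ B}) h ?_ hx
  intro x hx y hy a b ha hb hab
  simp only [Set.mem_ofPred_eq, cross_add_right, cross_smul_right] at *
  obtain rfl : b = 1 - a := by linarith
  nlinarith

theorem dot_le_of_hull {s : Set Plane} {w : Plane} {B : ℝ} (h : ∀ x ∈ s, dot w x ≤ B) {x : Plane}
    (hx : x ∈ convexHull ℝ s) : dot w x ≤ B := by
  refine convexHull_min (t := {x | dot w x ≤ B}) h ?_ hx
  intro x hx y hy a b ha hb hab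
  have e : dot w (a • x + b • y) = a * dot w x + b * dot w y := by
    simp only [dot, PiLp.add_apply, PiLp.smul_apply, smul_eq_mul]; ring
  simp only [Set.mem_ofPred_eq, e] at *
  obtain rfl : b = 1 - a := by linarith
  nlinarith

/-- A vertex of a polygon, with the two edges through it. -/
theorem exists_adjacent_edges {s : Finset Plane} {H : Set Plane}
    (hH : H = convexHull ℝ (s : Set Plane)) (hint : (interior H).Nonempty) :
    ∃ P w w' : Plane, ∃ C ℓ ℓ', 0 < cross w w' ∧ 0 < ℓ ∧ 0 < ℓ' ∧ IsMinFace H w C ℓ ∧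
      C + ℓ • w = P ∧ IsMinFace H w' P ℓ' := by
  have hconv : Convex ℝ H := hH ▸ convex_convexHull _ _
  have hcomp : IsCompact H := hH ▸ s.finite_toSet.isCompact_convexHull ℝ
  have hsH : ∀ x ∈ s, x ∈ H := fun x hx => hH ▸ subset_convexHull ℝ _ hx
  obtain ⟨o, ho⟩ := hint
  have hne : H.Nonempty := ⟨o, interior_subset ho⟩
  have hsne : s.Nonempty := by
    rw [hH] at hne
    exact_mod_cast convexHull_nonempty_iff.1 hne
  -- A point of `s` farthest from the origin is a vertex, strictly exposed by the functional `dot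
  -- P`.
  obtain ⟨P, hP, hPmax⟩ := s.exists_max_image (fun x => dot x x) hsne
  have hg : ∀ x ∈ s, x ≠ P → 0 < dot P (P - x) := by
    intro x hx hxP
    have h1 := hPmax x hx
    have h2 := dot_self_pos (sub_ne_zero.2 hxP)
    simp only [dot, PiLp.sub_apply] at *
    nlinarith
  have hPH : ∀ y ∈ H, dot P y ≤ dot P P := by
    intro y hy
    rw [hH] at hy
    refine dot_le_of_hull (fun x hx => ?_) hy
    by_cases hxP : x = P
    · rw [hxP]
    · have := hg x hx hxP
      simp only [dot, PiLp.sub_apply] at *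
      linarith
  have hne2 : (s.erase P).Nonempty := by
    rw [Finset.nonempty_iff_ne_empty]
    intro hemp
    have : (s : Set Plane) = {P} := by
      rw [← Finset.insert_erase hP, hemp]; simp
    rw [hH, this, convexHull_singleton] at ho
    simp at ho
  have hmem : ∀ x ∈ s.erase P, x ∈ s ∧ 0 < dot P (P - x) := fun x hx =>
    ⟨Finset.mem_of_mem_erase hx, hg x (Finset.mem_of_mem_erase hx) (Finset.ne_of_mem_erase hx)⟩
  have hP0 : 0 < dot P P := by
    obtain ⟨x, hx⟩ := hne2
    apply dot_self_pos
    rintro rfl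
    simpa [dot] using (hmem x hx).2
  -- Seen from `P`, the other points lie in an open half plane, so the ratio `cross / dot` orders
  -- them by angle. Its extreme values select the two edges at `P`.
  have hslope : ∀ x y, 0 < dot P (P - x) → 0 < dot P (P - y) →
      cross P (P - x) / dot P (P - x) ≤ cross P (P - y) / dot P (P - y) →
      0 ≤ cross (x - P) (y - P) := by
    intro x y hx hy h
    rw [div_le_div_iff₀ hx hy] at h
    have : dot P P * cross (x - P) (y - P) =
        cross P (P - y) * dot P (P - x) - cross P (P - x) * dot P (P - y) := by
      simp only [cross, dot, PiLp.sub_apply]; ring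
    by_contra hcon
    push Not at hcon
    nlinarith
  obtain ⟨a, ha, hamax⟩ := (s.erase P).exists_max_image
    (fun x => cross P (P - x) / dot P (P - x)) hne2
  obtain ⟨b, hb, hbmin⟩ := (s.erase P).exists_min_image
    (fun x => cross P (P - x) / dot P (P - x)) hne2
  obtain ⟨has, hga⟩ := hmem a ha
  obtain ⟨hbs, hgb⟩ := hmem b hb
  have hamin : ∀ y ∈ H, cross (P - a) P ≤ cross (P - a) y := by
    intro y hy
    rw [hH] at hy
    have := cross_le_of_hull (w := -(P - a)) (B := cross (-(P - a)) P) (fun x hx => ?_) hy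
    · simpa only [cross_neg_left, neg_le_neg_iff] using this
    · by_cases hxP : x = P
      · rw [hxP]
      · have hx' := Finset.mem_erase.2 ⟨hxP, hx⟩
        have := hslope x a (hmem x hx').2 hga (hamax x hx')
        have e : cross (x - P) (a - P) = cross (-(P - a)) P - cross (-(P - a)) x := by
          simp only [cross, PiLp.sub_apply, PiLp.neg_apply]; ring
        linarith
  have hbmin' : ∀ y ∈ H, cross (b - P) P ≤ cross (b - P) y := by
    intro y hy
    rw [hH] at hy
    have := cross_le_of_hull (w := -(b - P)) (B := cross (-(b - P)) P) (fun x hx => ?_) hy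
    · simpa only [cross_neg_left, neg_le_neg_iff] using this
    · by_cases hxP : x = P
      · rw [hxP]
      · have hx' := Finset.mem_erase.2 ⟨hxP, hx⟩
        have := hslope b x hgb (hmem x hx').2 (hbmin x hx')
        have e : cross (b - P) (x - P) = cross (-(b - P)) P - cross (-(b - P)) x := by
          simp only [cross, PiLp.sub_apply, PiLp.neg_apply]; ring
        linarith
  have hwa : P - a ≠ 0 := sub_ne_zero.2 (Finset.ne_of_mem_erase ha).symm
  have hwb : b - P ≠ 0 := sub_ne_zero.2 (Finset.ne_of_mem_erase hb)
  obtain ⟨C, ℓ, hC⟩ := exists_isMinFace hcomp hconv hne hwa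
  obtain ⟨D, ℓ', hD⟩ := exists_isMinFace hcomp hconv hne hwb
  have hgb' : dot P (b - P) < 0 := by
    simp only [dot, PiLp.sub_apply] at *; linarith
  have hCP : C + ℓ • (P - a) = P := by
    obtain ⟨r, r0, r1, hr⟩ := (hC.2 P).1 ⟨hsH P hP, hamin⟩
    have h1 := hPH _ (hC.mem hC.1 le_rfl)
    have h2 : C + ℓ • (P - a) = P + (ℓ - r) • (P - a) := by
      conv_rhs => rw [show P + (ℓ - r) • (P - a) = (P - r • (P - a)) + ℓ • (P - a) by module]
      congr 1
      exact eq_sub_of_add_eq hr.symm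
    have h3 : dot P (P + (ℓ - r) • (P - a)) = dot P P + (ℓ - r) * dot P (P - a) := by
      simp only [dot, PiLp.add_apply, PiLp.smul_apply, smul_eq_mul]; ring
    rw [h2, h3] at h1
    have h4 : ℓ = r := by nlinarith
    rw [h2, h4, sub_self, zero_smul, add_zero]
  have hDP : D = P := by
    obtain ⟨r, r0, r1, hr⟩ := (hD.2 P).1 ⟨hsH P hP, hbmin'⟩
    have h1 := hPH _ (hD.mem le_rfl hD.1)
    rw [zero_smul, add_zero] at h1
    have h3 : dot P P = dot P D + r * dot P (b - P) := by
      conv_lhs => rw [show dot P P = dot P (D + r • (b - P)) by rw [← hr]]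
      simp only [dot, PiLp.add_apply, PiLp.smul_apply, smul_eq_mul]; ring
    have h4 : r = 0 := by nlinarith
    rw [hr, h4, zero_smul, add_zero]
  subst hDP
  refine ⟨D, D - a, b - D, C, ℓ, ℓ', ?_, ?_, ?_, hC, hCP, hD⟩
  · have h0 : 0 ≤ cross (D - a) (b - D) := by
      rw [cross_sub_right]; linarith [hamin b (hsH b hbs)]
    refine h0.lt_of_ne fun h0 => ?_
    obtain ⟨κ, hκ⟩ := eq_smul_of_cross_eq_zero hwa h0.symm
    have h1 := hD.lt_of_mem_interior hwb ho
    have h2 := hC.lt_of_mem_interior hwa ho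
    have h3 : cross (D - a) C = cross (D - a) D := by
      have := congrArg (cross (D - a)) hCP
      rw [cross_add_right, cross_smul_right, cross_same] at this
      linarith
    have h4 : dot D (b - D) = κ * dot D (D - a) := by
      rw [hκ]; simp only [dot, PiLp.smul_apply, smul_eq_mul]; ring
    have h5 : κ < 0 := by nlinarith
    rw [hκ, cross_smul_left, cross_smul_left] at h1
    nlinarith
  · refine hC.1.lt_of_ne fun h0 => ?_
    obtain ⟨r, r0, r1, hr⟩ := (hC.2 a).1 ⟨hsH a has, fun y hy => by
      have := hamin y hy
      have e : cross (D - a) a = cross (D - a) D := by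
        simp only [cross, PiLp.sub_apply]; ring
      linarith⟩
    rw [← h0, zero_smul, add_zero] at hCP
    obtain rfl : r = 0 := by linarith
    rw [zero_smul, add_zero, hCP] at hr
    exact Finset.ne_of_mem_erase ha hr
  · refine hD.1.lt_of_ne fun h0 => ?_
    obtain ⟨r, r0, r1, hr⟩ := (hD.2 b).1 ⟨hsH b hbs, fun y hy => by
      have := hbmin' y hy
      have e : cross (b - D) b = cross (b - D) D := by
        simp only [cross, PiLp.sub_apply]; ring
      linarith⟩
    obtain rfl : r = 0 := by linarith
    rw [zero_smul, add_zero] at hr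
    exact Finset.ne_of_mem_erase hb hr

/-- Otherwise an edge starting at `A` would have a direction strictly between `w` and `w'`. The
opposite face is the single point `P`, which minimizes both functionals, so opposite faces would
have different lengths. -/
theorem IsTiling.opposite_vertex_isMax {s : Finset Plane} {H T : Set Plane} (hT : IsTiling H T)
    (hH : H = convexHull ℝ (s : Set Plane)) {P w w' C A : Plane} {ℓ ℓ' : ℝ}
    (hww : 0 < cross w w') (hC : IsMinFace H w C ℓ) (hCP : C + ℓ • w = P)
    (hP : IsMinFace H w' P ℓ') (hA : IsMaxFace H w A ℓ) :
    ∀ y ∈ H, cross w' y ≤ cross w' A := by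
  have hAH : A ∈ H := by simpa using hA.mem le_rfl hA.1
  intro y hy
  by_contra hcon
  push Not at hcon
  set S := s.filter fun x => cross w' A < cross w' x with hS
  have hSne : S.Nonempty := by
    by_contra hemp
    rw [Finset.not_nonempty_iff_eq_empty, Finset.filter_eq_empty_iff] at hemp
    rw [hH] at hy
    exact absurd (cross_le_of_hull (fun x hx => not_lt.1 (hemp hx)) hy) hcon.not_ge
  -- The least ratio gives the first direction `w + lam • w'` whose supporting line at `A` also
  -- passes through another point `q`.
  obtain ⟨q, hq, hqmin⟩ := S.exists_min_image
    (fun x => (cross w A - cross w x) / (cross w' x - cross w' A)) hSne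
  rw [hS, Finset.mem_filter] at hq
  obtain ⟨hqs, hq'⟩ := hq
  have hqH : q ∈ H := hH ▸ subset_convexHull ℝ _ hqs
  set lam := (cross w A - cross w q) / (cross w' q - cross w' A) with hlam
  have hden : 0 < cross w' q - cross w' A := sub_pos.2 hq'
  have hnum : 0 < cross w A - cross w q := by
    refine (sub_nonneg.2 (hA.le hqH)).lt_of_ne fun h0 => ?_
    obtain ⟨r, r0, r1, hr⟩ := (hA.2 q).1 ⟨hqH, fun z hz => by linarith [hA.le hz]⟩
    rw [hr, cross_add_right, cross_smul_right, cross_swap w w'] at hq'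
    nlinarith
  have hlam0 : 0 < lam := div_pos hnum hden
  have hlamq : lam * (cross w' q - cross w' A) = cross w A - cross w q := by
    rw [hlam]; field_simp
  set v := w + lam • w' with hv
  have hcv : ∀ x, cross v x = cross w x + lam * cross w' x := by
    intro x; rw [hv, cross_add_left, cross_smul_left]
  have hmax : ∀ z ∈ H, cross v z ≤ cross v A := by
    intro z hz
    rw [hH] at hz
    refine cross_le_of_hull (fun x hx => ?_) hz
    have hxH : x ∈ H := hH ▸ subset_convexHull ℝ _ hx
    rw [hcv, hcv]
    by_cases hxS : cross w' A < cross w' x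
    · have h1 := hqmin x (Finset.mem_filter.2 ⟨hx, hxS⟩)
      rw [le_div_iff₀ (sub_pos.2 hxS)] at h1
      linarith
    · have := hA.le hxH
      nlinarith [not_lt.1 hxS]
  have hv0 : v ≠ 0 := by
    intro h0
    have : cross w v = lam * cross w w' := by
      rw [hv, cross_add_right, cross_smul_right, cross_same, zero_add]
    rw [h0, cross_zero_right] at this
    have : 0 < lam * cross w w' := by positivity
    linarith
  have hne : H.Nonempty := ⟨A, hAH⟩
  obtain ⟨A', m, hA'⟩ := exists_isMaxFace hT.isCompact hT.convex hne hv0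
  obtain ⟨C', m', hC'⟩ := exists_isMinFace hT.isCompact hT.convex hne hv0
  have hm : m' = m := hT.length_eq hv0 hA' hC'
  have hm0 : m ≠ 0 := by
    intro h0
    have hz : ∀ x, x ∈ H → cross v A ≤ cross v x → x = A' := by
      intro x hx hxA
      obtain ⟨r, r0, r1, hr⟩ := (hA'.2 x).1 ⟨hx, fun y hy => (hmax y hy).trans hxA⟩
      obtain rfl : r = 0 := by linarith
      simpa using hr
    have h1 := hz A hAH le_rfl
    have h2 := hz q hqH (by rw [hcv, hcv]; linarith)
    rw [h2, ← h1] at hq'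
    exact lt_irrefl _ hq'
  have hPmin : ∀ x ∈ H, cross w P ≤ cross w x := by
    intro x hx
    have e : cross w P = cross w C := by
      rw [← hCP, cross_add_right, cross_smul_right, cross_same]; ring
    rw [e]; exact hC.le hx
  have hPH : P ∈ H := by simpa using hP.mem le_rfl hP.1
  have huniq : ∀ x, x ∈ H → (∀ y ∈ H, cross v x ≤ cross v y) → x = P := by
    intro x hx hxmin
    have h1 := hxmin P hPH
    rw [hcv, hcv] at h1
    have h2 := hPmin x hx
    have h3 := hP.le hx
    have h4 : cross w (x - P) = 0 := by
      rw [cross_sub_right]; nlinarith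
    have h5 : cross w' (x - P) = 0 := by
      rw [cross_sub_right]; nlinarith
    exact sub_eq_zero.1 (eq_zero_of_cross_eq_zero hww.ne' h4 h5)
  have hc1 := (hC'.2 C').2 ⟨0, le_rfl, hC'.1, by simp⟩
  have hc2 := (hC'.2 (C' + m' • v)).2 ⟨m', hC'.1, le_rfl, rfl⟩
  have e1 := huniq _ hc1.1 hc1.2
  have e2 := huniq _ hc2.1 hc2.2
  rw [e1, add_eq_left, smul_eq_zero] at e2
  rcases e2 with h | h
  · exact hm0 (hm ▸ h)
  · exact hv0 h

/-- A convex polygon which tessellates the plane by translations is a parallelogram or a centrally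
symmetric hexagon. -/
theorem exists_zonogon_of_tile {H : Set Plane} (hH : H ∈ TranslationTiles) :
    ∃ c e₁ e₂ e₃, Ordered e₁ e₂ e₃ ∧ H = zonogon c e₁ e₂ e₃ := by
  obtain ⟨hpoly, T, hcov, hdis⟩ := hH
  have hT := IsTiling.of_tessellates hpoly hcov hdis
  obtain ⟨⟨s, hs⟩, hint⟩ := hpoly
  obtain ⟨P, w, w', C, ℓ, ℓ', hww, hℓ, hℓ', hC, hCP, hP⟩ := exists_adjacent_edges hs hint
  have hw : w ≠ 0 := by rintro rfl; simp at hww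
  have hw' : w' ≠ 0 := by rintro rfl; simp at hww
  have hne : H.Nonempty := hint.mono interior_subset
  obtain ⟨A, m, hA⟩ := exists_isMaxFace hT.isCompact hT.convex hne hw
  obtain ⟨B, m', hB⟩ := exists_isMaxFace hT.isCompact hT.convex hne hw'
  obtain rfl := hT.length_eq hw hA hC
  obtain rfl := hT.length_eq hw' hB hP
  by_cases hch : ∀ x L, x ∈ H → x + L • w ∈ H → L ≤ ℓ
  · exact hT.eq_parallelogram hw hA hC hℓ hch
  by_cases hch' : ∀ x L, x ∈ H → x + L • w' ∈ H → L ≤ ℓ'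
  · exact hT.eq_parallelogram hw' hB hP hℓ' hch'
  push Not at hch hch'
  obtain ⟨x, L, hx, hxL, hL⟩ := hch
  obtain ⟨x', L', hx', hxL', hL'⟩ := hch'
  have hAH : A ∈ H := by simpa using hA.mem le_rfl hA.1
  have hBH : B ∈ H := by simpa using hB.mem le_rfl hB.1
  have hCH : C ∈ H := by simpa using hC.mem le_rfl hC.1
  have hPH : P ∈ H := by simpa using hP.mem le_rfl hP.1
  have hRH : A + ℓ • w ∈ H := hA.mem hA.1 le_rfl
  have hQH : P + ℓ' • w' ∈ H := hP.mem hP.1 le_rfl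
  have hAB : A = B + ℓ' • w' := by
    obtain ⟨r, r0, r1, hr⟩ := (hB.2 A).1 ⟨hAH, hT.opposite_vertex_isMax hs hww hC hCP hP hA⟩
    have h1 := hA.le (hB.mem hB.1 le_rfl)
    rw [hr, cross_add_right, cross_add_right, cross_smul_right, cross_smul_right] at h1
    have : ℓ' = r := by nlinarith
    rw [this]; exact hr
  -- The six points `C`, `P`, `P + ℓ' • w'`, `A + ℓ • w`, `A`, `B`, in this order, are the vertices
  -- of a zonogon contained in `H`.
  set e₃ := A + ℓ • w - (P + ℓ' • w') with he₃
  have hord : Ordered (ℓ • w) (ℓ' • w') e₃ := by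
    have h12 : 0 < cross (ℓ • w) (ℓ' • w') := by
      rw [cross_smul_left, cross_smul_right]; positivity
    have h23 : 0 ≤ cross (ℓ' • w') e₃ := by
      rw [cross_smul_left, he₃, cross_sub_right, cross_add_right w' P, cross_smul_right ℓ' w' w',
        cross_same]
      have := hP.le hRH
      apply mul_nonneg hℓ'.le
      linarith
    have h13 : 0 ≤ cross (ℓ • w) e₃ := by
      rw [cross_smul_left, he₃, cross_sub_right, cross_add_right w A, cross_smul_right ℓ w w,
        cross_same]
      have := hA.le hQH
      apply mul_nonneg hℓ.le
      linarith
    exact ⟨h12.le, h23, h13, by unfold crossSum; linarith⟩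
  have hsub : zonogon (C + (1 / 2 : ℝ) • (ℓ • w + ℓ' • w' + e₃)) (ℓ • w) (ℓ' • w') e₃ ⊆ H := by
    refine hord.zonogon_subset hT.convex hCH (hCP ▸ hPH) ?_ ?_ ?_ ?_
    · convert hQH using 1; rw [← hCP]; abel
    · convert hRH using 1; rw [he₃, ← hCP]; abel
    · convert hAH using 1; rw [he₃, ← hCP]; abel
    · convert hBH using 1; rw [he₃, hAB, ← hCP]; abel
  refine ⟨_, _, _, _, hord, Set.Subset.antisymm ?_ hsub⟩
  intro y hy
  by_contra hyZ
  have hcl : y ∈ closure (interior H) := by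
    rw [hT.convex.closure_interior_eq_closure_of_nonempty_interior hint]
    exact subset_closure hy
  obtain ⟨z, hzZ, hzi⟩ := mem_closure_iff.1 hcl _ (zonogon_isCompact _ _ _ _).isClosed.isOpen_compl
    hyZ
  -- A point `z` interior to `H` but outside the zonogon lies in a translate of the zonogon by a
  -- nonzero lattice vector. As `A - C = e₂ + e₃` and `B - P = e₃ - e₁` generate the lattice and
  -- preserve `T`, two tiles overlap.
  obtain ⟨j, k, hjk⟩ := zonogon_covers
    (c := C + (1 / 2 : ℝ) • (ℓ • w + ℓ' • w' + e₃)) hord z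
  obtain ⟨t, ht, -⟩ := hT.covers 0
  have t1 : ∀ t ∈ T, t + (A - C) ∈ T := fun t ht => hT.translation_mem hw hA hC hℓ hx hxL hL ht
  have t2 : ∀ t ∈ T, t - (A - C) ∈ T := fun t ht => hT.translation_mem_neg hw hA hC hℓ hx hxL hL ht
  have t3 : ∀ t ∈ T, t + (B - P) ∈ T :=
    fun t ht => hT.translation_mem hw' hB hP hℓ' hx' hxL' hL' ht
  have t4 : ∀ t ∈ T, t - (B - P) ∈ T :=
    fun t ht => hT.translation_mem_neg hw' hB hP hℓ' hx' hxL' hL' ht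
  have hmem := add_zsmul_mem_of_invariant t1 t2 (add_zsmul_mem_of_invariant t3 t4 ht (-j)) (j + k)
  set lam := (j : ℝ) • (ℓ • w + ℓ' • w') + (k : ℝ) • (ℓ' • w' + e₃) with hlam
  have hlam' : t + ((-j : ℤ) : ℝ) • (B - P) + ((j + k : ℤ) : ℝ) • (A - C) = t + lam := by
    rw [hlam, he₃, hAB, ← hCP]; push_cast; module
  rw [hlam'] at hmem
  refine hT.disjoint t ht _ hmem ?_ (t + z) (by simpa using hzi) ?_
  · intro h
    have h0 : lam = 0 := by simpa using h.symm
    rw [h0, sub_zero] at hjk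
    exact hzZ hjk
  · convert hsub hjk using 1
    abel

/-! ### Regular hexagons -/

theorem sqrt_three_mul_self : Real.sqrt 3 * Real.sqrt 3 = 3 := Real.mul_self_sqrt (by norm_num)

/-- The vector of length `r` with polar angle `φ`. -/
noncomputable def polar (r φ : ℝ) : Plane := !₂[r * Real.cos φ, r * Real.sin φ]

@[simp] theorem polar_zero_apply (r φ : ℝ) : polar r φ 0 = r * Real.cos φ := by simp [polar]
@[simp] theorem polar_one_apply (r φ : ℝ) : polar r φ 1 = r * Real.sin φ := by simp [polar]

theorem polar_add (r φ δ : ℝ) :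
    polar r (φ + δ) = Real.cos δ • polar r φ + Real.sin δ • rot (polar r φ) := by
  refine plane_ext ?_ ?_ <;> simp only [polar_zero_apply, polar_one_apply, PiLp.add_apply,
    PiLp.smul_apply, smul_eq_mul, rot_zero_apply, rot_one_apply, Real.cos_add, Real.sin_add] <;>
    ring

theorem polar_add_pi (r φ : ℝ) : polar r (φ + Real.pi) = -polar r φ := by
  refine plane_ext ?_ ?_ <;> simp

theorem exists_polar (x : Plane) : ∃ φ, x = polar (Real.sqrt (dot x x)) φ := by
  refine ⟨Complex.arg ⟨x 0, x 1⟩, ?_⟩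
  have h : Real.sqrt (dot x x) = ‖(⟨x 0, x 1⟩ : ℂ)‖ := by
    rw [Complex.norm_def, Complex.normSq_mk]; rfl
  rw [h]
  refine plane_ext ?_ ?_
  · simp [Complex.norm_mul_cos_arg]
  · simp [Complex.norm_mul_sin_arg]

theorem dot_polar (r φ : ℝ) : dot (polar r φ) (polar r φ) = r ^ 2 := by
  simp only [dot, polar_zero_apply, polar_one_apply]
  linear_combination r ^ 2 * Real.cos_sq_add_sin_sq φ

theorem cross_polar (r φ δ : ℝ) : cross (polar r φ) (polar r (φ + δ)) = r ^ 2 * Real.sin δ := by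
  rw [polar_add, cross_add_right, cross_smul_right, cross_smul_right, cross_same, cross_rot_self,
    dot_polar]
  ring

theorem cos_two_pi_div_three : Real.cos (2 * (Real.pi / 3)) = -(1 / 2) := by
  rw [Real.cos_two_mul, Real.cos_pi_div_three]; norm_num

theorem sin_two_pi_div_three : Real.sin (2 * (Real.pi / 3)) = Real.sqrt 3 / 2 := by
  rw [Real.sin_two_mul, Real.sin_pi_div_three, Real.cos_pi_div_three]; ring

theorem polar_add_two_thirds (r φ : ℝ) :
    polar r (φ + 2 * (Real.pi / 3)) = polar r (φ + Real.pi / 3) - polar r φ := by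
  rw [polar_add, polar_add, cos_two_pi_div_three, sin_two_pi_div_three, Real.cos_pi_div_three,
    Real.sin_pi_div_three]
  module

/-- The regular hexagon with centre `c`, circumradius `r` and orientation `θ`, as a zonogon. -/
noncomputable def hexagon (c : Plane) (r θ : ℝ) : Set Plane :=
  zonogon c (polar r θ) (polar r (θ + Real.pi / 3)) (polar r (θ + 2 * (Real.pi / 3)))

theorem ordered_polar {r : ℝ} (hr : 0 < r) (θ : ℝ) :
    Ordered (polar r θ) (polar r (θ + Real.pi / 3)) (polar r (θ + 2 * (Real.pi / 3))) ∧
    crossSum (polar r θ) (polar r (θ + Real.pi / 3)) (polar r (θ + 2 * (Real.pi / 3))) =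
      r ^ 2 * (3 * Real.sqrt 3 / 2) := by
  have h1 := cross_polar r θ (Real.pi / 3)
  have h2 := cross_polar r (θ + Real.pi / 3) (Real.pi / 3)
  have h3 := cross_polar r θ (2 * (Real.pi / 3))
  rw [show θ + Real.pi / 3 + Real.pi / 3 = θ + 2 * (Real.pi / 3) by ring] at h2
  rw [Real.sin_pi_div_three] at h1 h2
  rw [sin_two_pi_div_three] at h3
  have hs : 0 < Real.sqrt 3 := by positivity
  have hsum : crossSum (polar r θ) (polar r (θ + Real.pi / 3))
      (polar r (θ + 2 * (Real.pi / 3))) = r ^ 2 * (3 * Real.sqrt 3 / 2) := by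
    unfold crossSum; rw [h1, h2, h3]; ring
  refine ⟨⟨?_, ?_, ?_, ?_⟩, hsum⟩
  · rw [h1]; positivity
  · rw [h2]; positivity
  · rw [h3]; positivity
  · rw [hsum]; positivity

theorem convexHull_eq_hexagon {r : ℝ} (hr : 0 < r) (c : Plane) (θ : ℝ) :
    convexHull ℝ (Set.range fun k : Fin 6 =>
      c + !₂[r * Real.cos (θ + (k : ℕ) * (Real.pi / 3)),
             r * Real.sin (θ + (k : ℕ) * (Real.pi / 3))]) = hexagon c r θ := by
  change convexHull ℝ (Set.range fun k : Fin 6 => c + polar r (θ + (k : ℕ) * (Real.pi / 3))) = _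
  set E := fun k : Fin 6 => c + polar r (θ + (k : ℕ) * (Real.pi / 3)) with hE
  have h2 := polar_add_two_thirds r θ
  have e0 : E 0 = c + polar r θ := by simp [hE]
  have e1 : E 1 = c + polar r (θ + Real.pi / 3) := by simp [hE]
  have e2 : E 2 = c + polar r (θ + 2 * (Real.pi / 3)) := by simp [hE]
  have e3 : E 3 = c - polar r θ := by
    rw [sub_eq_add_neg, ← polar_add_pi, hE]
    have : θ + ((3 : Fin 6) : ℕ) * (Real.pi / 3) = θ + Real.pi := by
      change θ + ((3 : ℕ) : ℝ) * _ = _; push_cast; ring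
    simp only [this]
  have e4 : E 4 = c - polar r (θ + Real.pi / 3) := by
    rw [sub_eq_add_neg, ← polar_add_pi, hE]
    have : θ + ((4 : Fin 6) : ℕ) * (Real.pi / 3) = θ + Real.pi / 3 + Real.pi := by
      change θ + ((4 : ℕ) : ℝ) * _ = _; push_cast; ring
    simp only [this]
  have e5 : E 5 = c - polar r (θ + 2 * (Real.pi / 3)) := by
    rw [sub_eq_add_neg, ← polar_add_pi, hE]
    have : θ + ((5 : Fin 6) : ℕ) * (Real.pi / 3) = θ + 2 * (Real.pi / 3) + Real.pi := by
      change θ + ((5 : ℕ) : ℝ) * _ = _; push_cast; ring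
    simp only [this]
  have hmem : ∀ k, E k ∈ convexHull ℝ (Set.range E) := fun k =>
    subset_convexHull ℝ _ ⟨k, rfl⟩
  unfold hexagon
  apply Set.Subset.antisymm
  · refine convexHull_min ?_ (zonogon_convex _ _ _ _)
    have k1 : |(1 / 2 : ℝ)| ≤ 1 / 2 := by norm_num
    have k2 : |(-1 / 2 : ℝ)| ≤ 1 / 2 := by norm_num [abs_le]
    rintro _ ⟨k, rfl⟩
    fin_cases k
    · exact ⟨1 / 2, 1 / 2, -1 / 2, k1, k1, k2, by change E 0 = _; rw [e0, h2]; module⟩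
    · exact ⟨1 / 2, 1 / 2, 1 / 2, k1, k1, k1, by change E 1 = _; rw [e1, h2]; module⟩
    · exact ⟨-1 / 2, 1 / 2, 1 / 2, k2, k1, k1, by change E 2 = _; rw [e2, h2]; module⟩
    · exact ⟨-1 / 2, -1 / 2, 1 / 2, k2, k2, k1, by change E 3 = _; rw [e3, h2]; module⟩
    · exact ⟨-1 / 2, -1 / 2, -1 / 2, k2, k2, k2, by change E 4 = _; rw [e4, h2]; module⟩
    · exact ⟨1 / 2, -1 / 2, -1 / 2, k1, k2, k2, by change E 5 = _; rw [e5, h2]; module⟩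
  · have key := (ordered_polar hr θ).1.zonogon_subset (convex_convexHull ℝ (Set.range E))
      (P := c - polar r (θ + Real.pi / 3)) (e4 ▸ hmem 4) ?_ ?_ ?_ ?_ ?_
    · convert key using 2
      rw [h2]; module
    · convert hmem 5 using 1; rw [e5, h2]; abel
    · convert hmem 0 using 1; rw [e0]; abel
    · convert hmem 1 using 1; rw [e1, h2]; abel
    · convert hmem 2 using 1; rw [e2]; abel
    · convert hmem 3 using 1; rw [e3, h2]; abel

theorem isRegularHexagon_iff {R : Set Plane} :
    IsRegularHexagon R ↔ ∃ c r θ, 0 < r ∧ R = hexagon c r θ := by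
  constructor
  · rintro ⟨c, r, θ, hr, rfl⟩
    exact ⟨c, r, θ, hr, convexHull_eq_hexagon hr c θ⟩
  · rintro ⟨c, r, θ, hr, rfl⟩
    exact ⟨c, r, θ, hr, (convexHull_eq_hexagon hr c θ).symm⟩

/-- A zonogon with edge vectors of equal length making equal angles is a regular hexagon. -/
theorem Ordered.eq_hexagon {c e₁ e₂ e₃ : Plane} (h : Ordered e₁ e₂ e₃)
    (h12 : dot (e₁ - e₂) (e₁ + e₂) = 0) (h23 : dot (e₂ - e₃) (e₂ + e₃) = 0)
    (h3 : dot e₃ (e₁ + e₂) = 0) (h1 : dot e₁ (e₂ + e₃) = 0) :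
    ∃ θ, zonogon c e₁ e₂ e₃ = hexagon c (Real.sqrt (dot e₁ e₁)) θ ∧ 0 < dot e₁ e₁ ∧
      crossSum e₁ e₂ e₃ = dot e₁ e₁ * (3 * Real.sqrt 3 / 2) ∧
      energy 0 e₁ e₂ e₃ = 3 * dot e₁ e₁ := by
  have q12 : dot e₂ e₂ = dot e₁ e₁ := by
    simp only [dot, PiLp.add_apply, PiLp.sub_apply] at *; linarith
  have q23 : dot e₃ e₃ = dot e₂ e₂ := by
    simp only [dot, PiLp.add_apply, PiLp.sub_apply] at *; linarith
  have x13 : dot e₁ e₃ = -dot e₁ e₂ := by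
    simp only [dot, PiLp.add_apply] at *; linarith
  have x23 : dot e₂ e₃ = dot e₁ e₂ := by
    simp only [dot, PiLp.add_apply] at *; linarith
  have s12 := cross_sq_add_dot_sq e₁ e₂
  have s23 := cross_sq_add_dot_sq e₂ e₃
  have s13 := cross_sq_add_dot_sq e₁ e₃
  have hr := cross_relation e₁ e₂ e₃
  obtain ⟨n12, n23, n13, np⟩ := h
  have c23 : cross e₂ e₃ = cross e₁ e₂ := by
    apply (sq_eq_sq₀ n23 n12).1
    rw [x23, q23, q12] at s23; rw [q12] at s12; linarith
  have c13 : cross e₁ e₃ = cross e₁ e₂ := by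
    apply (sq_eq_sq₀ n13 n12).1
    rw [x13, q23, q12, neg_sq] at s13; rw [q12] at s12; linarith
  have hα : 0 < cross e₁ e₂ := by
    unfold crossSum at np; rw [c23, c13] at np; linarith
  -- All three determinants are equal and positive, so `cross_relation` reduces to this identity.
  have he3 : e₃ = e₂ - e₁ := by
    rw [c23, c13, ← smul_sub] at hr
    exact smul_right_injective _ hα.ne' hr
  have hQ : 0 < dot e₁ e₁ := dot_self_pos (by rintro rfl; simp at hα)
  have x12 : dot e₁ e₂ = dot e₁ e₁ / 2 := by
    have : dot e₁ e₃ = dot e₁ e₂ - dot e₁ e₁ := by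
      rw [he3]; simp only [dot, PiLp.sub_apply]; ring
    linarith
  have hcr : cross e₁ e₂ = dot e₁ e₁ * (Real.sqrt 3 / 2) := by
    apply (sq_eq_sq₀ n12 (by positivity)).1
    have := sqrt_three_mul_self
    rw [x12, q12] at s12
    linear_combination s12 - (dot e₁ e₁) ^ 2 / 4 * this
  obtain ⟨θ, hθ⟩ := exists_polar e₁
  set r := Real.sqrt (dot e₁ e₁) with hrdef
  have he2 : e₂ = (1 / 2 : ℝ) • e₁ + (Real.sqrt 3 / 2) • rot e₁ := by
    apply smul_right_injective _ hQ.ne'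
    simp only [smul_add, smul_smul]
    rw [← hcr, show dot e₁ e₁ * (1 / 2) = dot e₁ e₂ by rw [x12]; ring]
    refine plane_ext ?_ ?_ <;> simp only [cross, dot, PiLp.add_apply, PiLp.smul_apply, smul_eq_mul,
      rot_zero_apply, rot_one_apply] <;> ring
  have he2' : e₂ = polar r (θ + Real.pi / 3) := by
    rw [polar_add, Real.cos_pi_div_three, Real.sin_pi_div_three, ← hθ]; exact he2
  refine ⟨θ, ?_, hQ, ?_, ?_⟩
  · rw [hexagon, polar_add_two_thirds, ← he2', ← hθ, ← he3]
  · unfold crossSum; rw [c23, c13, hcr]; ring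
  · unfold energy; rw [q23, q12]; simp only [dot, PiLp.zero_apply]; ring

/-! ### Congruence of regular hexagons -/

/-- The rotation by the angle `δ` about the origin, composed with the translation taking `c` to
`c'`. -/
noncomputable def rotateAbout (c c' : Plane) (δ : ℝ) (x : Plane) : Plane :=
  c' + (Real.cos δ • (x - c) + Real.sin δ • rot (x - c))

theorem rotateAbout_isometry (c c' : Plane) (δ : ℝ) : Isometry (rotateAbout c c' δ) := by
  refine Isometry.of_dist_eq fun x y => ?_
  rw [dist_eq_norm, dist_eq_norm, ← sq_eq_sq₀ (norm_nonneg _) (norm_nonneg _), norm_sq_eq_dot,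
    norm_sq_eq_dot]
  simp only [rotateAbout, dot, PiLp.add_apply, PiLp.sub_apply, PiLp.smul_apply, smul_eq_mul,
    rot_zero_apply, rot_one_apply]
  linear_combination ((x 0 - y 0) ^ 2 + (x 1 - y 1) ^ 2) * Real.cos_sq_add_sin_sq δ

theorem rotateAbout_neg (c c' : Plane) (δ : ℝ) (x : Plane) :
    rotateAbout c c' δ (rotateAbout c' c (-δ) x) = x := by
  have h := Real.cos_sq_add_sin_sq δ
  refine plane_ext ?_ ?_ <;> simp only [rotateAbout, Real.cos_neg, Real.sin_neg, PiLp.add_apply,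
    PiLp.sub_apply, PiLp.smul_apply, smul_eq_mul, rot_zero_apply, rot_one_apply]
  · linear_combination (x 0 - c' 0) * h
  · linear_combination (x 1 - c' 1) * h

theorem hexagon_congruent (c c' : Plane) (r θ θ' : ℝ) :
    IsCongruentTo (hexagon c' r θ') (hexagon c r θ) := by
  refine ⟨IsometryEquiv.mk' (rotateAbout c c' (θ' - θ)) (rotateAbout c' c (-(θ' - θ)))
    (rotateAbout_neg _ _ _) (rotateAbout_isometry _ _ _), ?_⟩
  have hp : ∀ φ, polar r (φ + (θ' - θ)) = Real.cos (θ' - θ) • polar r φ +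
      Real.sin (θ' - θ) • rot (polar r φ) := fun φ => polar_add r φ _
  have a1 := hp θ
  have a2 := hp (θ + Real.pi / 3)
  have a3 := hp (θ + 2 * (Real.pi / 3))
  rw [show θ + (θ' - θ) = θ' by ring] at a1
  rw [show θ + Real.pi / 3 + (θ' - θ) = θ' + Real.pi / 3 by ring] at a2
  rw [show θ + 2 * (Real.pi / 3) + (θ' - θ) = θ' + 2 * (Real.pi / 3) by ring] at a3
  have hmap : ∀ x₁ x₂ x₃ : ℝ, rotateAbout c c' (θ' - θ) (c + x₁ • polar r θ +
      x₂ • polar r (θ + Real.pi / 3) + x₃ • polar r (θ + 2 * (Real.pi / 3))) =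
      c' + x₁ • polar r θ' + x₂ • polar r (θ' + Real.pi / 3) +
        x₃ • polar r (θ' + 2 * (Real.pi / 3)) := by
    intro x₁ x₂ x₃
    rw [a1, a2, a3]
    refine plane_ext ?_ ?_ <;> simp only [rotateAbout, PiLp.add_apply,
      PiLp.sub_apply, PiLp.smul_apply, smul_eq_mul, rot_zero_apply, rot_one_apply] <;> ring
  ext y
  constructor
  · rintro ⟨x₁, x₂, x₃, h1, h2, h3, rfl⟩
    exact ⟨_, ⟨x₁, x₂, x₃, h1, h2, h3, rfl⟩, hmap x₁ x₂ x₃⟩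
  · rintro ⟨_, ⟨x₁, x₂, x₃, h1, h2, h3, rfl⟩, rfl⟩
    exact ⟨x₁, x₂, x₃, h1, h2, h3, hmap x₁ x₂ x₃⟩

theorem volume_hexagon {r : ℝ} (hr : 0 < r) (c : Plane) (θ : ℝ) :
    MeasureTheory.volume (hexagon c r θ) = ENNReal.ofReal (r ^ 2 * (3 * Real.sqrt 3 / 2)) := by
  rw [hexagon, volume_zonogon (ordered_polar hr θ).1, (ordered_polar hr θ).2]

theorem radius_eq_of_volume_eq_one {c c' : Plane} {r r' θ θ' : ℝ} (hr : 0 < r) (hr' : 0 < r')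
    (h : MeasureTheory.volume (hexagon c r θ) = 1)
    (h' : MeasureTheory.volume (hexagon c' r' θ') = 1) : r = r' := by
  rw [volume_hexagon hr, ENNReal.ofReal_eq_one] at h
  rw [volume_hexagon hr', ENNReal.ofReal_eq_one] at h'
  have hs : 3 * Real.sqrt 3 / 2 ≠ 0 := by positivity
  exact (sq_eq_sq₀ hr.le hr'.le).1 (mul_right_cancel₀ hs (h.trans h'.symm))

/-! ### The compact family of zonogons of unit area -/

theorem exists_unit_direction {d : Plane} (hd : d ≠ 0) :
    ∃ v : Plane, ∃ L : ℝ, ‖v‖ = 1 ∧ 0 < L ∧ d = L • v := by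
  have h : 0 < ‖d‖ := norm_pos_iff.2 hd
  refine ⟨‖d‖⁻¹ • d, ‖d‖, ?_, h, ?_⟩
  · rw [norm_smul, norm_inv, norm_norm, inv_mul_cancel₀ h.ne']
  · rw [smul_smul, mul_inv_cancel₀ h.ne', one_smul]

/-- Points with the same coordinates `x₁`, `x₂`, `x₃` are paired. Convergence of the data therefore
implies Hausdorff convergence of the tiles. -/
theorem hausdorffDist_zonogon_le (c e₁ e₂ e₃ c' e₁' e₂' e₃' : Plane) :
    Metric.hausdorffDist (zonogon c e₁ e₂ e₃) (zonogon c' e₁' e₂' e₃') ≤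
      ‖c - c'‖ + ‖e₁ - e₁'‖ + ‖e₂ - e₂'‖ + ‖e₃ - e₃'‖ := by
  have key : ∀ {c e₁ e₂ e₃ c' e₁' e₂' e₃' : Plane}, ∀ x ∈ zonogon c e₁ e₂ e₃,
      ∃ y ∈ zonogon c' e₁' e₂' e₃', dist x y ≤
        ‖c - c'‖ + ‖e₁ - e₁'‖ + ‖e₂ - e₂'‖ + ‖e₃ - e₃'‖ := by
    rintro c e₁ e₂ e₃ c' e₁' e₂' e₃' _ ⟨x₁, x₂, x₃, h1, h2, h3, rfl⟩
    refine ⟨_, ⟨x₁, x₂, x₃, h1, h2, h3, rfl⟩, ?_⟩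
    have hx : ∀ (x : ℝ) (u : Plane), |x| ≤ 1 / 2 → ‖x • u‖ ≤ ‖u‖ := by
      intro x u hx
      rw [norm_smul, Real.norm_eq_abs]
      nlinarith [norm_nonneg u]
    rw [dist_eq_norm, show c + x₁ • e₁ + x₂ • e₂ + x₃ • e₃ -
      (c' + x₁ • e₁' + x₂ • e₂' + x₃ • e₃') =
      (c - c') + x₁ • (e₁ - e₁') + x₂ • (e₂ - e₂') + x₃ • (e₃ - e₃') by module]
    refine (norm_add_le _ _).trans (add_le_add ((norm_add_le _ _).trans (add_le_add
      ((norm_add_le _ _).trans (add_le_add le_rfl ?_)) ?_)) ?_)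
    · exact hx _ _ h1
    · exact hx _ _ h2
    · exact hx _ _ h3
  refine Metric.hausdorffDist_le_of_mem_dist (by positivity) key fun y hy => ?_
  obtain ⟨x, hx, hxy⟩ := key (c' := c) (e₁' := e₁) (e₂' := e₂) (e₃' := e₃) y hy
  refine ⟨x, hx, hxy.trans_eq ?_⟩
  rw [norm_sub_rev c' c, norm_sub_rev e₁' e₁, norm_sub_rev e₂' e₂, norm_sub_rev e₃' e₃]

/-- Centre and edge vectors of a zonogon. -/
abbrev ZonogonData := Plane × Plane × Plane × Plane

/-- The zonogon with given data. -/
def ZonogonData.toSet (q : ZonogonData) : Set Plane := zonogon q.1 q.2.1 q.2.2.1 q.2.2.2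

/-- The data describe a zonogon of unit area. -/
def ZonogonData.IsUnit (q : ZonogonData) : Prop :=
  Ordered q.2.1 q.2.2.1 q.2.2.2 ∧ crossSum q.2.1 q.2.2.1 q.2.2.2 = 1

/-- The energy of a zonogon. -/
noncomputable def ZonogonData.energy (q : ZonogonData) : ℝ :=
  _root_.energy q.1 q.2.1 q.2.2.1 q.2.2.2

/-- The cyclic permutation of the edge vectors. -/
def ZonogonData.shift (q : ZonogonData) : ZonogonData := (q.1, q.2.2.1, q.2.2.2, -q.2.1)

namespace ZonogonData

/-- The tile with given data. -/
def tile (q : ZonogonData) (h : q.IsUnit) : TranslationTiles :=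
  ⟨q.toSet, zonogon_mem_translationTiles h.1⟩

theorem toSet_shift (q : ZonogonData) : q.shift.toSet = q.toSet := zonogon_shift _ _ _ _

theorem IsUnit.shift {q : ZonogonData} (h : q.IsUnit) : q.shift.IsUnit :=
  ⟨h.1.shift, (crossSum_shift _ _ _).trans h.2⟩

theorem energy_shift (q : ZonogonData) : q.shift.energy = q.energy := by
  simp only [energy, shift, _root_.energy, dot, PiLp.neg_apply]; ring

theorem continuous_energy : Continuous energy := by
  unfold energy _root_.energy dot; fun_prop

theorem continuous_cross_comp {f g : ZonogonData → Plane} (hf : Continuous f) (hg : Continuous g) :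
    Continuous fun q => cross (f q) (g q) := by
  unfold cross; fun_prop

/-- The strict inequality in `Ordered` follows from unit area, so only closed conditions remain. -/
theorem isClosed_isUnit : IsClosed {q : ZonogonData | q.IsUnit} := by
  have h12 : Continuous fun q : ZonogonData => cross q.2.1 q.2.2.1 :=
    continuous_cross_comp (by fun_prop) (by fun_prop)
  have h23 : Continuous fun q : ZonogonData => cross q.2.2.1 q.2.2.2 :=
    continuous_cross_comp (by fun_prop) (by fun_prop)
  have h13 : Continuous fun q : ZonogonData => cross q.2.1 q.2.2.2 :=
    continuous_cross_comp (by fun_prop) (by fun_prop)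
  have : {q : ZonogonData | q.IsUnit} = {q | 0 ≤ cross q.2.1 q.2.2.1} ∩
      {q | 0 ≤ cross q.2.2.1 q.2.2.2} ∩ {q | 0 ≤ cross q.2.1 q.2.2.2} ∩
      {q | cross q.2.1 q.2.2.1 + cross q.2.2.1 q.2.2.2 + cross q.2.1 q.2.2.2 = 1} := by
    ext q
    constructor
    · rintro ⟨⟨a, b, c, -⟩, e⟩
      exact ⟨⟨⟨a, b⟩, c⟩, e⟩
    · rintro ⟨⟨⟨a, b⟩, c⟩, e⟩
      exact ⟨⟨a, b, c, by rw [crossSum]; exact one_pos.trans_eq e.symm⟩, e⟩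
  rw [this]
  exact (((isClosed_le continuous_const h12).inter (isClosed_le continuous_const h23)).inter
    (isClosed_le continuous_const h13)).inter
    (isClosed_eq ((h12.add h23).add h13) continuous_const)

theorem isBounded_energy_le (B : ℝ) : Bornology.IsBounded {q : ZonogonData | q.energy ≤ B} := by
  refine (Metric.isBounded_closedBall (x := (0 : ZonogonData)) (r := B + 1)).subset fun q hq => ?_
  have hq : q.energy ≤ B := hq
  unfold energy _root_.energy at hq
  simp only [← norm_sq_eq_dot] at hq
  have hn : ∀ u : Plane, ‖u‖ ^ 2 ≤ B → ‖u‖ ≤ B + 1 := by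
    intro u hu
    nlinarith [sq_nonneg (‖u‖ - 1)]
  have s1 := sq_nonneg ‖q.1‖
  have s2 := sq_nonneg ‖q.2.1‖
  have s3 := sq_nonneg ‖q.2.2.1‖
  have s4 := sq_nonneg ‖q.2.2.2‖
  rw [mem_closedBall_zero_iff, Prod.norm_def, Prod.norm_def, Prod.norm_def]
  exact max_le (hn _ (by linarith)) (max_le (hn _ (by linarith))
    (max_le (hn _ (by linarith)) (hn _ (by linarith))))

/-- A lower semicontinuous functional has closed sublevel sets in the space of data. -/
theorem isClosed_sublevel {F : TranslationTiles → EReal} (hlsc : HausdorffLSC F) (a : EReal) :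
    IsClosed {q : ZonogonData | ∃ h : q.IsUnit, F (q.tile h) ≤ a} := by
  refine IsSeqClosed.isClosed fun u q hu hq => ?_
  choose h hF using hu
  have hunit : q.IsUnit := isClosed_isUnit.isSeqClosed h hq
  refine ⟨hunit, (hlsc (fun n => (u n).tile (h n)) (q.tile hunit) ?_).trans
    (Filter.liminf_le_of_frequently_le' (Filter.Frequently.of_forall hF))⟩
  refine squeeze_zero (fun n => Metric.hausdorffDist_nonneg)
    (fun n => hausdorffDist_zonogon_le _ _ _ _ _ _ _ _) ?_
  have hc : Continuous fun p : ZonogonData =>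
      ‖p.1 - q.1‖ + ‖p.2.1 - q.2.1‖ + ‖p.2.2.1 - q.2.2.1‖ + ‖p.2.2.2 - q.2.2.2‖ := by fun_prop
  have h0 := (hc.tendsto q).comp hq
  simp only [sub_self, norm_zero, add_zero] at h0
  exact h0

/-- Symmetrization of the data, parallel to the unit vector `v`. -/
noncomputable def symm (v : Plane) (q : ZonogonData) : ZonogonData :=
  (perpProj v q.1, symmEdge₁ v q.2.1 q.2.2.1, symmEdge₂ v q.2.1 q.2.2.1, perpProj v q.2.2.2)

theorem IsUnit.symm {q : ZonogonData} (h : q.IsUnit) {v : Plane} {L : ℝ} (hv : ‖v‖ = 1)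
    (hd : q.2.1 + q.2.2.1 = L • v) : (q.symm v).IsUnit :=
  ⟨(h.1.symm hv hd).1, (h.1.symm hv hd).2.trans h.2⟩

theorem IsUnit.tile_symm {q : ZonogonData} (h : q.IsUnit) {v : Plane} {L : ℝ} (hv : ‖v‖ = 1)
    (hL : 0 < L) (hd : q.2.1 + q.2.2.1 = L • v) :
    ((q.symm v).tile (h.symm hv hd) : Set Plane) = steinerSymm v (q.tile h) :=
  (steinerSymm_zonogon h.1 hv hL hd).symm

theorem IsUnit.volume {q : ZonogonData} (h : q.IsUnit) :
    MeasureTheory.volume (q.tile h : Set Plane) = 1 := by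
  change MeasureTheory.volume (zonogon _ _ _ _) = 1
  rw [volume_zonogon h.1, h.2, ENNReal.ofReal_one]

end ZonogonData

theorem exists_zonogonData (H : TranslationTiles)
    (hH : MeasureTheory.volume (H : Set Plane) = 1) :
    ∃ q : ZonogonData, ∃ h : q.IsUnit, H = q.tile h := by
  obtain ⟨c, e₁, e₂, e₃, ho, hz⟩ := exists_zonogon_of_tile H.2
  rw [hz, volume_zonogon ho, ENNReal.ofReal_eq_one] at hH
  exact ⟨(c, e₁, e₂, e₃), ⟨ho, hH⟩, Subtype.ext hz⟩

/-! ### Reduction to regular hexagons -/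

theorem dot_eq_zero_of_smul {v x d : Plane} {L : ℝ} (hd : d = L • v) (h : dot x v = 0) :
    dot x d = 0 := by
  have : dot x d = L * dot x v := by
    rw [hd]; simp only [dot, PiLp.smul_apply, smul_eq_mul]; ring
  rw [this, h, mul_zero]

/-- Every tile of unit area can be replaced by a regular hexagon centred at the origin, without
increasing the functional. -/
theorem exists_regular_le {F : TranslationTiles → EReal} (hlsc : HausdorffLSC F)
    (hst : SteinerNonincreasing F) (H : TranslationTiles)
    (hH : MeasureTheory.volume (H : Set Plane) = 1) :
    ∃ q : ZonogonData, ∃ h : q.IsUnit, IsRegularHexagon (q.tile h : Set Plane) ∧ q.energy ≤ 2 ∧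
      F (q.tile h) ≤ F H := by
  obtain ⟨q₀, h₀, rfl⟩ := exists_zonogonData H hH
  set S := {q : ZonogonData | ∃ h : q.IsUnit, F (q.tile h) ≤ F (q₀.tile h₀)} with hS
  have hSc : IsCompact (S ∩ {q | q.energy ≤ q₀.energy}) :=
    Metric.isCompact_of_isClosed_isBounded
      ((ZonogonData.isClosed_sublevel hlsc _).inter
        (isClosed_le ZonogonData.continuous_energy continuous_const))
      ((ZonogonData.isBounded_energy_le _).subset Set.inter_subset_right)
  obtain ⟨q, ⟨hqS, hqe⟩, hqmin⟩ := hSc.exists_isMinOn ⟨q₀, ⟨h₀, le_rfl⟩, le_refl q₀.energy⟩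
    ZonogonData.continuous_energy.continuousOn
  -- Data above the energy cutoff cannot beat `q`, so the minimum over the compact part is a minimum
  -- over all of `S`.
  have hmin : ∀ p ∈ S, q.energy ≤ p.energy := by
    intro p hp
    rcases le_total p.energy q₀.energy with h | h
    · exact hqmin ⟨hp, h⟩
    · exact le_trans hqe h
  have hstep : ∀ p ∈ S, p.energy = q.energy →
      dot p.1 (p.2.1 + p.2.2.1) = 0 ∧ dot (p.2.1 - p.2.2.1) (p.2.1 + p.2.2.1) = 0 ∧
        dot p.2.2.2 (p.2.1 + p.2.2.1) = 0 := by
    rintro p ⟨hp, hpF⟩ hpe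
    obtain ⟨v, L, hv, hL, hd⟩ := exists_unit_direction hp.1.add_ne_zero
    have h1 := hmin (p.symm v) ⟨hp.symm hv hd, (hst v hv _ _ (hp.tile_symm hv hL hd)).trans hpF⟩
    have h2 : (p.symm v).energy = p.energy - dot p.1 v ^ 2 -
        dot (p.2.1 - p.2.2.1) v ^ 2 / 2 - dot p.2.2.2 v ^ 2 := energy_symm hv _ _ _ _
    have s1 := sq_nonneg (dot p.1 v)
    have s2 := sq_nonneg (dot (p.2.1 - p.2.2.1) v)
    have s3 := sq_nonneg (dot p.2.2.2 v)
    refine ⟨dot_eq_zero_of_smul hd ?_, dot_eq_zero_of_smul hd ?_, dot_eq_zero_of_smul hd ?_⟩ <;>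
      apply pow_eq_zero_iff two_ne_zero |>.1 <;> linarith
  obtain ⟨hq, hqF⟩ := hqS
  -- The shifted data describe the same tile with the same energy, so minimality also applies to the
  -- diagonal `e₂ + e₃`.
  have hshift : q.shift ∈ S :=
    ⟨hq.shift, by rwa [show q.shift.tile hq.shift = q.tile hq from Subtype.ext q.toSet_shift]⟩
  obtain ⟨a1, a2, a3⟩ := hstep q ⟨hq, hqF⟩ rfl
  obtain ⟨b1, b2, b3⟩ := hstep q.shift hshift q.energy_shift
  simp only [ZonogonData.shift] at b1 b2 b3
  obtain ⟨θ, hθ, hpos, hcs, hen⟩ := hq.1.eq_hexagon (c := q.1) a2 b2 a3 (by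
    simp only [dot, PiLp.neg_apply, PiLp.add_apply] at b3 ⊢; linarith)
  -- The centre is orthogonal to two independent diagonals.
  have hc : q.1 = 0 := by
    have hcr : cross (rot (q.2.1 + q.2.2.1)) (rot (q.2.2.1 + q.2.2.2)) ≠ 0 := by
      have : cross (rot (q.2.1 + q.2.2.1)) (rot (q.2.2.1 + q.2.2.2)) =
          cross (q.2.1 + q.2.2.1) (q.2.2.1 + q.2.2.2) := by
        simp only [cross, rot_zero_apply, rot_one_apply]; ring
      rw [this, cross_add_add_eq_crossSum, hq.2]
      exact one_ne_zero
    have hrot : ∀ u x : Plane, dot x u = 0 → cross (rot u) x = 0 := by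
      intro u x h
      have : cross (rot u) x = -dot x u := by
        simp only [cross, dot, rot_zero_apply, rot_one_apply]; ring
      rw [this, h, neg_zero]
    exact eq_zero_of_cross_eq_zero hcr (hrot _ _ a1) (hrot _ _ b1)
  refine ⟨q, hq, isRegularHexagon_iff.2 ⟨q.1, _, θ, Real.sqrt_pos.2 hpos, hθ⟩, ?_, hqF⟩
  have he : q.energy = 3 * dot q.2.1 q.2.1 := by
    rw [← hen, ZonogonData.energy, hc]
  rw [he]
  rw [hq.2] at hcs
  -- The energy equals `2 / √3`; any uniform bound would serve, and `2` is convenient.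
  have h3 : (3 : ℝ) / 2 ≤ Real.sqrt 3 := Real.le_sqrt_of_sq_le (by norm_num)
  nlinarith

/-- Every unit-area tile is dominated by a regular hexagon with energy at most `2`, so the minimum
over the compact set `K` is global. Replacing the point of `K` attaining it by a regular hexagon
does not raise `F`. -/
theorem exists_regular_minimizer {F : TranslationTiles → EReal} (hlsc : HausdorffLSC F)
    (hst : SteinerNonincreasing F) :
    ∃ H : TranslationTiles, IsRegularHexagon (H : Set Plane) ∧ IsUnitAreaMinimizer F H := by
  classical
  set K := {q : ZonogonData | q.IsUnit} ∩ {q | q.energy ≤ 2} with hK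
  have hKc : IsCompact K := Metric.isCompact_of_isClosed_isBounded
    (ZonogonData.isClosed_isUnit.inter
      (isClosed_le ZonogonData.continuous_energy continuous_const))
    ((ZonogonData.isBounded_energy_le _).subset Set.inter_subset_right)
  have hKne : K.Nonempty := by
    have hunit : ZonogonData.IsUnit ((0, !₂[1, 0], !₂[0, 1], 0) : ZonogonData) := by
      refine ⟨⟨?_, ?_, ?_, ?_⟩, ?_⟩ <;> simp [crossSum, cross]
    obtain ⟨q, hq, -, hqe, -⟩ := exists_regular_le hlsc hst _ hunit.volume
    exact ⟨q, hq, hqe⟩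
  set G : ZonogonData → EReal := fun q => if h : q.IsUnit then F (q.tile h) else ⊤ with hG
  have hGlsc : LowerSemicontinuousOn G K := by
    refine lowerSemicontinuousOn_iff_preimage_Iic.2 fun b =>
      ⟨_, ZonogonData.isClosed_sublevel hlsc b, ?_⟩
    ext q
    refine and_congr_right fun hq => ?_
    have hq1 : q.IsUnit := hq.1
    have hGq : G q = F (q.tile hq1) := dif_pos hq1
    rw [Set.mem_preimage, hGq]
    exact ⟨fun h => ⟨hq1, h⟩, fun ⟨_, h⟩ => h⟩
  obtain ⟨q₀, ⟨hq₀, -⟩, hmin⟩ := hGlsc.exists_isMinOn hKne hKc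
  have hq₀ : q₀.IsUnit := hq₀
  obtain ⟨q, hq, hreg, -, hle⟩ := exists_regular_le hlsc hst _ hq₀.volume
  refine ⟨q.tile hq, hreg, hq.volume, fun H hH => ?_⟩
  obtain ⟨p, hp, -, hpe, hpF⟩ := exists_regular_le hlsc hst H hH
  have h1 : G q₀ ≤ G p := hmin ⟨hp, hpe⟩
  simp only [hG, dif_pos hq₀, dif_pos hp] at h1
  exact hle.trans (h1.trans hpF)

/-! ### The case of equality -/

/-- The right choice of signs makes the width bound an equality, so the sums are the widths of the
zonogons, which are monotone under inclusion and unaffected by translation. -/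
theorem width_le_of_translate {c e₁ e₂ e₃ c' e₁' e₂' e₃' t : Plane}
    (h : ∀ y ∈ zonogon c e₁ e₂ e₃, t + y ∈ zonogon c' e₁' e₂' e₃') (u : Plane) :
    |cross u e₁| + |cross u e₂| + |cross u e₃| ≤
      |cross u e₁'| + |cross u e₂'| + |cross u e₃'| := by
  have hsign : ∀ a : ℝ, ∃ x : ℝ, |x| ≤ 1 / 2 ∧ x * a = |a| / 2 := by
    intro a
    rcases abs_cases a with ⟨ha, -⟩ | ⟨ha, -⟩
    · exact ⟨1 / 2, by norm_num, by rw [ha]; ring⟩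
    · exact ⟨-1 / 2, by norm_num [abs_le], by rw [ha]; ring⟩
  obtain ⟨x₁, k1, l1⟩ := hsign (cross u e₁)
  obtain ⟨x₂, k2, l2⟩ := hsign (cross u e₂)
  obtain ⟨x₃, k3, l3⟩ := hsign (cross u e₃)
  have p1 := abs_cross_zonogon_le u (h _ ⟨x₁, x₂, x₃, k1, k2, k3, rfl⟩)
  have p2 := abs_cross_zonogon_le u (h _ ⟨-x₁, -x₂, -x₃, by rwa [abs_neg], by rwa [abs_neg],
    by rwa [abs_neg], rfl⟩)
  rw [abs_le] at p1 p2
  simp only [cross_sub_right, cross_add_right, cross_smul_right] at p1 p2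
  linarith [p1.2, p2.1]

/-- If the symmetrized zonogon is a translate of the original one, then the zonogon is symmetric. -/
theorem symmetric_of_translate {c e₁ e₂ e₃ v : Plane} {L : ℝ}
    (hv : ‖v‖ = 1) (hL : 0 < L) (hd : e₁ + e₂ = L • v)
    (htr : IsTranslateOf (zonogon (perpProj v c) (symmEdge₁ v e₁ e₂) (symmEdge₂ v e₁ e₂)
      (perpProj v e₃)) (zonogon c e₁ e₂ e₃)) :
    dot e₃ (e₁ + e₂) = 0 ∧ (0 < cross e₁ e₂ → dot (e₁ - e₂) (e₁ + e₂) = 0) := by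
  obtain ⟨t, ht⟩ := htr
  have hw : ∀ u, |cross u e₁| + |cross u e₂| + |cross u e₃| =
      |cross u (symmEdge₁ v e₁ e₂)| + |cross u (symmEdge₂ v e₁ e₂)| + |cross u (perpProj v e₃)| := by
    intro u
    apply le_antisymm
    · refine width_le_of_translate (c := c) (c' := perpProj v c) (t := t) (fun y hy => ?_) u
      rw [ht]; exact ⟨y, hy, rfl⟩
    · refine width_le_of_translate (c := perpProj v c) (c' := c) (t := -t) (fun y hy => ?_) u
      rw [ht] at hy
      obtain ⟨x, hx, rfl⟩ := hy
      simpa using hx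
  have hvv := dot_self_of_norm_eq_one hv
  set k := dot (e₁ - e₂) v with hk
  have hs1 : symmEdge₁ v e₁ e₂ = e₁ - (k / 2) • v := by
    have := eq_dot_smul_add_perpProj hv (e₁ - e₂)
    rw [symmEdge₁, eq_sub_of_add_eq' this.symm]; module
  have hs2 : symmEdge₂ v e₁ e₂ = e₂ + (k / 2) • v := by
    have := eq_dot_smul_add_perpProj hv (e₁ - e₂)
    rw [symmEdge₂, eq_sub_of_add_eq' this.symm]; module
  have hcr : ∀ x, cross (rot v) x = -dot x v := by
    intro x; simp only [cross, dot, rot_zero_apply, rot_one_apply]; ring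
  have hde : dot e₁ v + dot e₂ v = L := by
    have : dot e₁ v + dot e₂ v = dot (e₁ + e₂) v := by
      simp only [dot, PiLp.add_apply]; ring
    rw [this, hd]
    have : dot (L • v) v = L * dot v v := by
      simp only [dot, PiLp.smul_apply, smul_eq_mul]; ring
    rw [this, hvv, mul_one]
  have hk' : k = dot e₁ v - dot e₂ v := by
    rw [hk]; simp only [dot, PiLp.sub_apply]; ring
  -- With `u = rot v` the symmetrized zonogon has extent exactly `L`, while the original has at
  -- least `L` from `e₁` and `e₂`. Nothing is left for `e₃`.
  have h3 : dot e₃ v = 0 := by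
    have h0 := hw (rot v)
    rw [hs1, hs2] at h0
    have d1 : dot (e₁ - (k / 2) • v) v = dot e₁ v - k / 2 * dot v v := by
      simp only [dot, PiLp.sub_apply, PiLp.smul_apply, smul_eq_mul]; ring
    have d2 : dot (e₂ + (k / 2) • v) v = dot e₂ v + k / 2 * dot v v := by
      simp only [dot, PiLp.add_apply, PiLp.smul_apply, smul_eq_mul]; ring
    simp only [hcr, abs_neg, dot_perpProj, d1, d2, hvv, abs_zero] at h0
    rw [show dot e₁ v - k / 2 * 1 = L / 2 by linarith,
      show dot e₂ v + k / 2 * 1 = L / 2 by linarith, abs_of_pos (half_pos hL)] at h0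
    have q1 := le_abs_self (dot e₁ v)
    have q2 := le_abs_self (dot e₂ v)
    have q3 := abs_nonneg (dot e₃ v)
    exact abs_eq_zero.1 (by linarith)
  refine ⟨dot_eq_zero_of_smul hd h3, fun hα => dot_eq_zero_of_smul hd ?_⟩
  have he3 : perpProj v e₃ = e₃ := by
    conv_rhs => rw [eq_dot_smul_add_perpProj hv e₃, h3, zero_smul, zero_add]
  have hv1 : L * cross e₁ v = cross e₁ e₂ := by
    rw [← cross_smul_right, ← hd, cross_add_right, cross_same, zero_add]
  have hv2 : L * cross e₂ v = -cross e₁ e₂ := by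
    rw [← cross_smul_right, ← hd, cross_add_right, cross_same, add_zero, cross_swap e₁ e₂]
  set α := cross e₁ e₂ with hαdef
  have c1 : cross e₁ v = α / L := by rw [eq_div_iff hL.ne']; linarith
  have c2 : cross e₂ v = -(α / L) := by
    rw [← neg_div, eq_div_iff hL.ne']; linarith
  have w1 := hw e₁
  have w2 := hw e₂
  rw [hs1, hs2, he3, add_left_inj] at w1 w2
  simp only [cross_sub_right, cross_add_right, cross_smul_right, cross_same, c1, c2,
    cross_swap e₁ e₂, ← hαdef, abs_neg, abs_zero, zero_add, add_zero, abs_of_pos hα] at w1 w2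
  set m := k / 2 * (α / L) with hm
  -- The widths for `e₁` and `e₂` read `α = |m| + |α + m|` and `α = |α - m| + |m|`. Their sum is at
  -- least `2 * α + 2 * |m|`.
  have hm0 : m = 0 := by
    rw [zero_sub, abs_neg] at w1
    rw [show -α - k / 2 * -(α / L) = -(α - m) by rw [hm]; ring,
      show k / 2 * -(α / L) = -m by rw [hm]; ring, abs_neg, abs_neg] at w2
    have r1 := le_abs_self (α + m)
    have r2 := le_abs_self (α - m)
    have r3 := abs_nonneg m
    exact abs_eq_zero.1 (by linarith)
  have hpos : α / L ≠ 0 := by positivity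
  have := (mul_eq_zero.1 hm0).resolve_right hpos
  linarith

/-- A zonogon with two parallel edge vectors is a parallelogram. -/
theorem Ordered.zonogon_eq_parallelogram {c e₁ e₂ e₃ : Plane} (h : Ordered e₁ e₂ e₃)
    (h0 : cross e₁ e₂ = 0) :
    zonogon c e₁ e₂ e₃ = zonogon c (e₁ + e₂) ((1 / 2 : ℝ) • e₃) ((1 / 2 : ℝ) • e₃) := by
  have hd := h.add_ne_zero
  obtain ⟨-, h23, h13, hp⟩ := h
  obtain ⟨l, hl⟩ := eq_smul_of_cross_eq_zero (x := e₁) hd (by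
    rw [cross_add_left, cross_same, zero_add, cross_swap e₁ e₂, h0, neg_zero])
  set d := e₁ + e₂ with hddef
  have he2 : e₂ = (1 - l) • d := by rw [sub_smul, one_smul, ← hl, hddef]; abel
  have hde : 0 < cross d e₃ := by
    rw [hddef, cross_add_left]; unfold crossSum at hp; linarith
  have l0 : 0 ≤ l := by
    rw [hl, cross_smul_left] at h13
    exact nonneg_of_mul_nonneg_left h13 hde
  have l1 : 0 ≤ 1 - l := by
    rw [he2, cross_smul_left] at h23
    exact nonneg_of_mul_nonneg_left h23 hde
  clear_value d
  subst he2 hl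
  ext y
  constructor
  · rintro ⟨x₁, x₂, x₃, k1, k2, k3, rfl⟩
    refine ⟨l * x₁ + (1 - l) * x₂, x₃, x₃, ?_, k3, k3, by module⟩
    rw [abs_le] at *
    constructor <;> nlinarith
  · rintro ⟨x₁, x₂, x₃, k1, k2, k3, rfl⟩
    refine ⟨x₁, x₁, (x₂ + x₃) / 2, k1, k1, ?_, by module⟩
    rw [abs_le] at *
    constructor <;> linarith

/-- A symmetrization that is not a translate would strictly lower `F` at the same area. -/
theorem minimizer_symmetric {F : TranslationTiles → EReal} (hstrict : SteinerStrict F)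
    {q : ZonogonData} (h : q.IsUnit) (hmin : IsUnitAreaMinimizer F (q.tile h)) :
    dot q.2.2.2 (q.2.1 + q.2.2.1) = 0 ∧
      (0 < cross q.2.1 q.2.2.1 → dot (q.2.1 - q.2.2.1) (q.2.1 + q.2.2.1) = 0) := by
  obtain ⟨v, L, hv, hL, hd⟩ := exists_unit_direction h.1.add_ne_zero
  refine symmetric_of_translate (c := q.1) hv hL hd ?_
  by_contra hne
  have h1 := hstrict v hv _ _ (h.tile_symm hv hL hd) hne
  exact absurd (hmin.2 _ (h.symm hv hd).volume) h1.not_ge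

/-- A parallelogram with edges `d` and `e` is also the zonogon of `d`, `e / 2`, `e / 2`, whose
diagonal `d + e / 2` joins a vertex to the midpoint of an edge. Symmetry along it requires `dot d e
= -dot e e / 2` and `dot d d = dot e e / 4`, which make `d` and `e` parallel. -/
theorem minimizer_cross_pos {F : TranslationTiles → EReal} (hstrict : SteinerStrict F)
    {q : ZonogonData} (h : q.IsUnit) (hmin : IsUnitAreaMinimizer F (q.tile h)) :
    0 < cross q.2.1 q.2.2.1 := by
  refine h.1.nonneg₁₂.lt_of_ne fun h0 => ?_
  set d := q.2.1 + q.2.2.1 with hd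
  set e := q.2.2.2 with he
  have hde : cross d e = 1 := by
    have := h.2
    unfold crossSum at this
    rw [hd, cross_add_left]; linarith
  have hunit : ZonogonData.IsUnit ((q.1, d, (1 / 2 : ℝ) • e, (1 / 2 : ℝ) • e) : ZonogonData) := by
    refine ⟨⟨?_, ?_, ?_, ?_⟩, ?_⟩ <;> simp [crossSum, cross_same, hde]
    norm_num
  have htile : q.tile h = ZonogonData.tile _ hunit :=
    Subtype.ext (h.1.zonogon_eq_parallelogram h0.symm)
  rw [htile] at hmin
  obtain ⟨a, b⟩ := minimizer_symmetric hstrict hunit hmin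
  have b := b (by simp [hde])
  have hs := cross_sq_add_dot_sq d e
  rw [hde] at hs
  have a' : dot d e = -dot e e / 2 := by
    simp only [dot, PiLp.add_apply, PiLp.smul_apply, smul_eq_mul] at a ⊢; linarith
  have b' : dot d d = dot e e / 4 := by
    simp only [dot, PiLp.add_apply, PiLp.sub_apply, PiLp.smul_apply, smul_eq_mul] at b ⊢
    linarith
  rw [a', b'] at hs
  linarith

theorem minimizer_isRegularHexagon {F : TranslationTiles → EReal} (hstrict : SteinerStrict F)
    (H : TranslationTiles) (hmin : IsUnitAreaMinimizer F H) : IsRegularHexagon (H : Set Plane) := by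
  obtain ⟨q, h, rfl⟩ := exists_zonogonData H hmin.1
  have hmin' : IsUnitAreaMinimizer F (q.shift.tile h.shift) := by
    rwa [show q.shift.tile h.shift = q.tile h from Subtype.ext q.toSet_shift]
  obtain ⟨a3, a2⟩ := minimizer_symmetric hstrict h hmin
  obtain ⟨b3, b2⟩ := minimizer_symmetric hstrict h.shift hmin'
  have a2 := a2 (minimizer_cross_pos hstrict h hmin)
  have b2 := b2 (minimizer_cross_pos hstrict h.shift hmin')
  simp only [ZonogonData.shift] at b2 b3
  obtain ⟨θ, hθ, hpos, -⟩ := h.1.eq_hexagon (c := q.1) a2 b2 a3 (by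
    simp only [dot, PiLp.neg_apply, PiLp.add_apply] at b3 ⊢; linarith)
  exact isRegularHexagon_iff.2 ⟨q.1, _, θ, Real.sqrt_pos.2 hpos, hθ⟩

theorem theorem3p1 (F : TranslationTiles → EReal) (hbot : ∀ H, F H ≠ ⊥)
    (hlsc : HausdorffLSC F) (hst : SteinerNonincreasing F) :
    (∃ Hstar : TranslationTiles,
      IsRegularHexagon (Hstar : Set Plane) ∧ IsUnitAreaMinimizer F Hstar) ∧
    (CongruenceInvariant F → ∀ R : Set Plane, IsRegularHexagon R → MeasureTheory.volume R = 1 →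
      ∃ hR : R ∈ TranslationTiles, IsUnitAreaMinimizer F ⟨R, hR⟩) ∧
    (SteinerStrict F → ∀ H : TranslationTiles, IsUnitAreaMinimizer F H →
      IsRegularHexagon (H : Set Plane)) := by
  obtain ⟨Hstar, hreg, hmin⟩ := exists_regular_minimizer hlsc hst
  refine ⟨⟨Hstar, hreg, hmin⟩, fun hcong R hR hvol => ?_, fun hstrict H hH =>
    minimizer_isRegularHexagon hstrict H hH⟩
  obtain ⟨c, r, θ, hr, rfl⟩ := isRegularHexagon_iff.1 hR
  obtain ⟨c', r', θ', hr', hstar⟩ := isRegularHexagon_iff.1 hreg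
  -- Area fixes the circumradius, so any two regular hexagons of unit area are congruent.
  obtain rfl := radius_eq_of_volume_eq_one hr hr' hvol (hstar ▸ hmin.1)
  refine ⟨zonogon_mem_translationTiles (ordered_polar hr θ).1, hvol, fun K hK => ?_⟩
  have hF := hcong Hstar ⟨hexagon c r θ, zonogon_mem_translationTiles (ordered_polar hr θ).1⟩
    (hstar ▸ hexagon_congruent c' c r θ' θ)
  exact hF.le.trans (hmin.2 K hK)
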